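/- Let $J=[0,+\infty)$ and let $\mathcal L(\mathbb R^n)$ be the space of real $n\times n$ matrices, with the operator norm induced by a norm $\|\cdot\|$ on $\mathbb R^n$. Let $A\colon J\to\mathcal L(\mathbb R^n)$ be of bounded variation on every compact subinterval of $J$, and suppose that $I-(A(t)-A(t^-))$ is invertible for every $t>0$ and that $I+(A(t^+)-A(t))$ is invertible for every $t\ge 0$. For $a\le b$, a function $G\colon[a,b]\times[a,b]\to X$ with values in a normed space $X$ has Kurzweil integral $\int_a^b DG(\tau,t)=\mathcal I\in X$ if for every $\varepsilon>0$ there is a function $\delta\colon[a,b]\to(0,\infty)$ such that $$\Big\|\sum_{j=1}^{\nu}\big[G(\tau_j,\alpha_j)-G(\tau_j,\alpha_{j-1})\big]-\mathcal I\Big\|<\varepsilon$$ for all $a=\alpha_0<\alpha_1<\dots<\alpha_\nu=b$ and $\tau_j\in[\alpha_{j-1},\alpha_j]$ with $[\alpha_{j-1},\alpha_j]\subset(\tau_j-\delta(\tau_j),\tau_j+\delta(\tau_j))$ for $j=1,\dots,\nu$; moreover $\int_b^a=-\int_a^b$ and $\int_a^a=0$. A function $x\colon[s_0,+\infty)\to\mathbb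 R^n$, $s_0\ge0$, is a solution on $[s_0,+\infty)$ of the homogeneous generalized linear differential equation (GLDE) $\frac{dx}{d\tau}=D[A(t)x]$ if $x(d)-x(c)=\int_c^d D[A(t)x(\tau)]$ whenever $s_0\le c\le d$. The trivial solution $x\equiv0$ is uniformly stable if for every $\varepsilon>0$ there is $\delta>0$ such that, for every $s_0\ge0$ and $x_0\in\mathbb R^n$ with $\|x_0\|<\delta$, the solution $x$ on $[s_0,+\infty)$ with $x(s_0)=x_0$ satisfies $\|x(t)\|<\varepsilon$ for all $t\ge s_0$. Then there is a unique function $U\colon J\times J\to\mathcal L(\mathbb R^n)$, the transition matrix of the GLDE, such that $$U(t,s)=I+\int_s^t D[A(r)U(\tau,s)]\qquad\text{for all }t,s\in J,$$ where the integral is the Kurzweil integral of $G(\tau,r)=A(r)U(\tau,s)$; and the trivial solution of the GLDE is uniformly stable if and only if there is a constant $C$ with $\|U(t,s_0)\|\le C$ for all $t\ge s_0\ge 0$. -/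

import Mathlib

open Set

namespace GLDE

/-- A tagged partition `{([α_j, α_{j+1}], τ_j) : j < ν}` of the interval `[a, b]`, that is
`a = α_0 < α_1 < ⋯ < α_ν = b` and `τ_j ∈ [α_j, α_{j+1}]`. Only the values `pt j` for `j ≤ ν`
and `tag j` for `j < ν` matter. For `a = b` the only partition has `ν = 0`. -/
structure TaggedPartition (a b : ℝ) where
  /-- the number of subintervals -/
  ν : ℕ
  /-- the division points -/
  pt : ℕ → ℝ
  /-- the tags -/
  tag : ℕ → ℝ
  pt_zero : pt 0 = a
  pt_last : pt ν = b
  pt_lt : ∀ j < ν, pt j < pt (j + 1)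
  tag_mem : ∀ j < ν, tag j ∈ Icc (pt j) (pt (j + 1))

/-- `δ` is a gauge on `[a, b]`. -/
def IsGauge (δ : ℝ → ℝ) (a b : ℝ) : Prop :=
  ∀ t ∈ Icc a b, 0 < δ t

/-- `δ`-fineness: `[α_j, α_{j+1}] ⊆ (τ_j - δ(τ_j), τ_j + δ(τ_j))` for every `j`. -/
def TaggedPartition.IsFine {a b : ℝ} (P : TaggedPartition a b) (δ : ℝ → ℝ) : Prop :=
  ∀ j < P.ν, Icc (P.pt j) (P.pt (j + 1)) ⊆
    Ioo (P.tag j - δ (P.tag j)) (P.tag j + δ (P.tag j))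

section Integral

variable {X : Type*} [NormedAddCommGroup X]

/-- The sum `∑_j [G(τ_j, α_{j+1}) - G(τ_j, α_j)]`. -/
def TaggedPartition.kurzweilSum {a b : ℝ} (P : TaggedPartition a b) (G : ℝ → ℝ → X) : X :=
  ∑ j ∈ Finset.range P.ν, (G (P.tag j) (P.pt (j + 1)) - G (P.tag j) (P.pt j))

/-- For `a ≤ b`: the function `G` is Kurzweil integrable on `[a, b]` with integral `I`. -/
def HasKurzweilIntegral (G : ℝ → ℝ → X) (a b : ℝ) (I : X) : Prop :=
  ∀ ε : ℝ, 0 < ε → ∃ δ : ℝ → ℝ, IsGauge δ a b ∧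
    ∀ P : TaggedPartition a b, P.IsFine δ → ‖P.kurzweilSum G - I‖ < ε

/-- The oriented Kurzweil integral from `a` to `b` exists and equals `I`, with the convention
`∫_a^b = -∫_b^a` when `b < a`. -/
def HasOrientedKurzweilIntegral (G : ℝ → ℝ → X) (a b : ℝ) (I : X) : Prop :=
  (a ≤ b → HasKurzweilIntegral G a b I) ∧ (b < a → HasKurzweilIntegral G b a (-I))

end Integral

section Equation

variable {E : Type*} [NormedAddCommGroup E] [NormedSpace ℝ E]

/-- The jump condition on the coefficient `A : [0, ∞) → L(E)`: `I - Δ⁻A(t)` is invertible for all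
`t > 0` and `I + Δ⁺A(t)` is invertible for all `t ≥ 0`, where `Δ⁻A(t) = A(t) - A(t⁻)` and
`Δ⁺A(t) = A(t⁺) - A(t)`. -/
def ConditionD (A : ℝ → E →L[ℝ] E) : Prop :=
  (∀ t : ℝ, 0 < t → IsUnit (1 - (A t - Function.leftLim A t))) ∧
  (∀ t : ℝ, 0 ≤ t → IsUnit (1 + (Function.rightLim A t - A t)))

/-- `x` is a solution of the homogeneous equation `dx/dτ = D[A(t)x]` on the interval `J`:
`x(d) - x(c) = ∫_c^d D[A(t)x(τ)]` whenever `[c, d] ⊆ J`. -/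
def IsSolutionOn (A : ℝ → E →L[ℝ] E) (J : Set ℝ) (x : ℝ → E) : Prop :=
  ∀ c d : ℝ, c ≤ d → Icc c d ⊆ J →
    HasKurzweilIntegral (fun τ t => A t (x τ)) c d (x d - x c)

/-- `U` is a transition matrix of `dx/dτ = D[A(t)x]` on `[0, ∞)`:
`U(t, s) = I + ∫_s^t d[A(r)] U(r, s)` for all `t, s ≥ 0`. -/
def IsTransitionMatrix (A : ℝ → E →L[ℝ] E) (U : ℝ → ℝ → E →L[ℝ] E) : Prop :=
  ∀ t s : ℝ, 0 ≤ t → 0 ≤ s →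
    HasOrientedKurzweilIntegral (fun τ r => A r ∘L U τ s) s t
      (U t s - ContinuousLinearMap.id ℝ E)

/-- The trivial solution of `dx/dτ = D[A(t)x]` on `[0, ∞)` is uniformly stable. -/
def UniformlyStable (A : ℝ → E →L[ℝ] E) : Prop :=
  ∀ ε : ℝ, 0 < ε → ∃ δ : ℝ, 0 < δ ∧ ∀ s₀ : ℝ, 0 ≤ s₀ → ∀ x₀ : E, ‖x₀‖ < δ →
    ∀ x : ℝ → E, IsSolutionOn A (Ici s₀) x → x s₀ = x₀ → ∀ t ≥ s₀, ‖x t‖ < ε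

end Equation

end GLDE

namespace GLDE

open Filter Topology

/-! Let `μ` be the variation function of `A`, so that increments of `A` are bounded by those of `μ`.
Everything is local: near a point `t`, the one-sided variation of `A` that leaves out the jump at
`t` itself is arbitrarily small, and `interval_induction` passes from local to global.

Uniqueness rests on `IsSolutionOn.eq_zero_iff`: the zero set of a solution is open and closed in an
interval. Near a zero, the bound on the solution can be halved repeatedly. Near a nonzero value `x
t`, the one-sided limits are `(I + Δ⁺A(t)) x(t)` and `(I - Δ⁻A(t)) x(t)`, nonzero by the
invertibility of the jumps.

Existence comes from Euler steps, explicit in the first half and implicit in the second, on finite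
sets of points (`exists_discrete_solution`). The estimates do not depend on the finite set, so
compactness gives a limit (`exists_incrementEstimate`) whose increments agree with those of the
equation up to `o(μ)`; such a function has the required Kurzweil integrals. Local solutions are
glued to an everywhere invertible `Φ`, and `U(t,s) = Φ(t) Φ(s)⁻¹`.

Solutions from `s₀` are exactly `U(t,s₀) x₀` (`IsTransitionMatrix.eq_apply`), so by linearity
uniform stability is a uniform bound on `U`. -/

/-- Induction along an interval: a transitive relation that holds between every point and the
nearby points on either side holds between the end points. -/
theorem interval_induction {P : ℝ → ℝ → Prop} {a b : ℝ} (hab : a ≤ b)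
    (trans : ∀ u v w, a ≤ u → u ≤ v → v ≤ w → w ≤ b → P u v → P v w → P u w)
    (loc : ∀ t ∈ Icc a b, ∃ δ > 0, (∀ u ∈ Icc a b, t - δ < u → u ≤ t → P u t) ∧
      ∀ v ∈ Icc a b, t ≤ v → v < t + δ → P t v) : P a b := by
  let S : Set ℝ := {t | t ∈ Icc a b ∧ P a t}
  have haS : a ∈ S := by
    obtain ⟨δ, hδ, h, -⟩ := loc a ⟨le_rfl, hab⟩
    exact ⟨⟨le_rfl, hab⟩, h a ⟨le_rfl, hab⟩ (by linarith) le_rfl⟩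
  have hbdd : BddAbove S := ⟨b, fun t ht => ht.1.2⟩
  have hs : sSup S ∈ Icc a b := ⟨le_csSup hbdd haS, csSup_le ⟨a, haS⟩ fun t ht => ht.1.2⟩
  obtain ⟨δ, hδ, hl, hr⟩ := loc _ hs
  obtain ⟨t, htS, ht⟩ := exists_lt_of_lt_csSup ⟨a, haS⟩ (show sSup S - δ < sSup S by linarith)
  have hts : t ≤ sSup S := le_csSup hbdd htS
  have hPs : P a (sSup S) :=
    trans a t _ le_rfl htS.1.1 hts hs.2 htS.2 (hl t htS.1 ht hts)
  have key : ∀ v ∈ Icc a b, sSup S ≤ v → v < sSup S + δ → v ∈ S := fun v hv h1 h2 =>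
    ⟨hv, trans a _ v le_rfl hs.1 h1 hv.2 hPs (hr v hv h1 h2)⟩
  have hmin : min (sSup S + δ / 2) b ∈ S :=
    key _ ⟨le_min (by linarith [hs.1]) hab, min_le_right _ _⟩ (le_min (by linarith) hs.2)
      (lt_of_le_of_lt (min_le_left _ _) (by linarith))
  have hle := le_csSup hbdd hmin
  rcases min_choice (sSup S + δ / 2) b with h | h
  · rw [h] at hle; linarith
  · rw [h] at hmin; exact hmin.2

/-! ### Tagged partitions and Cousin's lemma -/

namespace TaggedPartition

variable {a b c : ℝ}

theorem pt_mono (P : TaggedPartition a b) {i j : ℕ} (hij : i ≤ j) (hj : j ≤ P.ν) :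
    P.pt i ≤ P.pt j := by
  induction j, hij using Nat.le_induction with
  | base => exact le_rfl
  | succ k hk ih => exact (ih (by omega)).trans (P.pt_lt k (by omega)).le

theorem pt_mem (P : TaggedPartition a b) {j : ℕ} (hj : j ≤ P.ν) : P.pt j ∈ Icc a b := by
  have h1 := P.pt_mono (Nat.zero_le j) hj
  have h2 := P.pt_mono hj le_rfl
  rw [P.pt_zero] at h1
  rw [P.pt_last] at h2
  exact ⟨h1, h2⟩

theorem tag_mem_Icc (P : TaggedPartition a b) {j : ℕ} (hj : j < P.ν) : P.tag j ∈ Icc a b :=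
  ⟨(P.pt_mem hj.le).1.trans (P.tag_mem j hj).1,
    (P.tag_mem j hj).2.trans (P.pt_mem (show j + 1 ≤ P.ν from hj)).2⟩

/-- The partition of a degenerate interval. -/
def refl (a : ℝ) : TaggedPartition a a where
  ν := 0
  pt := fun _ => a
  tag := fun _ => a
  pt_zero := rfl
  pt_last := rfl
  pt_lt := by simp
  tag_mem := by simp

/-- The partition into a single interval. -/
def single {τ : ℝ} (hab : a < b) (hτ : τ ∈ Icc a b) : TaggedPartition a b where
  ν := 1
  pt := fun j => if j = 0 then a else b
  tag := fun _ => τ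
  pt_zero := by simp
  pt_last := by simp
  pt_lt := by simpa using hab
  tag_mem := by simpa using hτ

/-- Concatenation of partitions of adjacent intervals. -/
def append (P : TaggedPartition a b) (Q : TaggedPartition b c) : TaggedPartition a c where
  ν := P.ν + Q.ν
  pt := fun j => if j < P.ν then P.pt j else Q.pt (j - P.ν)
  tag := fun j => if j < P.ν then P.tag j else Q.tag (j - P.ν)
  pt_zero := by
    by_cases h : 0 < P.ν
    · simp [h, P.pt_zero]
    · have h0 : P.ν = 0 := by omega
      have h1 := P.pt_last
      rw [h0, P.pt_zero] at h1
      simp [h0, Q.pt_zero, h1]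
  pt_last := by simp [Q.pt_last]
  pt_lt := by
    intro j hj
    by_cases h : j + 1 < P.ν
    · simpa [h, show j < P.ν by omega] using P.pt_lt j (by omega)
    · by_cases h' : j < P.ν
      · have h2 : j + 1 = P.ν := by omega
        have h3 := P.pt_lt j h'
        rw [h2, P.pt_last] at h3
        simpa [h', h2, Q.pt_zero] using h3
      · have h3 := Q.pt_lt (j - P.ν) (by omega)
        rw [← Nat.sub_add_comm (by omega)] at h3
        simpa [h, h'] using h3
  tag_mem := by
    intro j hj
    by_cases h : j + 1 < P.ν
    · simpa [h, show j < P.ν by omega] using P.tag_mem j (by omega)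
    · by_cases h' : j < P.ν
      · have h2 : j + 1 = P.ν := by omega
        have h3 := P.tag_mem j h'
        rw [h2, P.pt_last] at h3
        simpa [h', h2, Q.pt_zero] using h3
      · have h3 := Q.tag_mem (j - P.ν) (by omega)
        rw [← Nat.sub_add_comm (by omega)] at h3
        simpa [h, h'] using h3

theorem append_left (P : TaggedPartition a b) (Q : TaggedPartition b c) {j : ℕ} (hj : j < P.ν) :
    (P.append Q).pt j = P.pt j ∧ (P.append Q).pt (j + 1) = P.pt (j + 1) ∧
      (P.append Q).tag j = P.tag j := by
  refine ⟨by simp [append, hj], ?_, by simp [append, hj]⟩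
  by_cases h : j + 1 < P.ν
  · simp [append, h]
  · have h2 : j + 1 = P.ν := by omega
    simp [append, h2, Q.pt_zero, P.pt_last]

theorem append_right (P : TaggedPartition a b) (Q : TaggedPartition b c) (j : ℕ) :
    (P.append Q).pt (P.ν + j) = Q.pt j ∧ (P.append Q).pt (P.ν + j + 1) = Q.pt (j + 1) ∧
      (P.append Q).tag (P.ν + j) = Q.tag j := by
  refine ⟨by simp [append], ?_, by simp [append]⟩
  simp [append, add_assoc]

theorem IsFine.append {P : TaggedPartition a b} {Q : TaggedPartition b c} {δ : ℝ → ℝ}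
    (hP : P.IsFine δ) (hQ : Q.IsFine δ) : (P.append Q).IsFine δ := by
  intro j hj
  by_cases h : j < P.ν
  · obtain ⟨h1, h2, h3⟩ := append_left P Q h
    rw [h1, h2, h3]
    exact hP j h
  · obtain ⟨k, rfl⟩ := Nat.exists_eq_add_of_le (not_lt.1 h)
    obtain ⟨h1, h2, h3⟩ := append_right P Q k
    rw [h1, h2, h3]
    exact hQ k (by have : P.ν + k < P.ν + Q.ν := hj
                   omega)

theorem IsFine.mono {P : TaggedPartition a b} {δ δ' : ℝ → ℝ} (hP : P.IsFine δ)
    (h : ∀ t, δ t ≤ δ' t) : P.IsFine δ' := fun j hj =>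
  (hP j hj).trans (Ioo_subset_Ioo (by linarith [h (P.tag j)]) (by linarith [h (P.tag j)]))

theorem isFine_refl (a : ℝ) (δ : ℝ → ℝ) : (refl a).IsFine δ := by
  intro j hj
  simp [refl] at hj

theorem isFine_single {τ : ℝ} (hab : a < b) (hτ : τ ∈ Icc a b) {δ : ℝ → ℝ}
    (h1 : τ - δ τ < a) (h2 : b < τ + δ τ) : (single hab hτ).IsFine δ := by
  intro j hj
  have : j = 0 := by simp [single] at hj; exact hj
  subst this
  simpa [single] using Icc_subset_Ioo h1 h2

/-- Cousin's lemma. -/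
theorem exists_isFine (hab : a ≤ b) {δ : ℝ → ℝ} (hδ : IsGauge δ a b) :
    ∃ P : TaggedPartition a b, P.IsFine δ := by
  refine interval_induction (P := fun u v => ∃ P : TaggedPartition u v, P.IsFine δ) hab ?_ ?_
  · rintro u v w - - - - ⟨P, hP⟩ ⟨Q, hQ⟩
    exact ⟨P.append Q, hP.append hQ⟩
  · intro t ht
    refine ⟨δ t, hδ t ht, fun u hu h1 h2 => ?_, fun v hv h1 h2 => ?_⟩
    · rcases h2.eq_or_lt with rfl | h2
      · exact ⟨refl u, isFine_refl _ _⟩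
      · exact ⟨single h2 (right_mem_Icc.2 h2.le), isFine_single _ _ h1 (by linarith [hδ t ht])⟩
    · rcases h1.eq_or_lt with rfl | h1
      · exact ⟨refl t, isFine_refl _ _⟩
      · exact ⟨single h1 (left_mem_Icc.2 h1.le), isFine_single _ _ (by linarith [hδ t ht]) h2⟩

variable {X : Type*} [NormedAddCommGroup X]

theorem kurzweilSum_append (P : TaggedPartition a b) (Q : TaggedPartition b c) (G : ℝ → ℝ → X) :
    (P.append Q).kurzweilSum G = P.kurzweilSum G + Q.kurzweilSum G := by
  unfold kurzweilSum
  rw [show (P.append Q).ν = P.ν + Q.ν from rfl, Finset.sum_range_add]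
  congr 1
  · refine Finset.sum_congr rfl fun j hj => ?_
    obtain ⟨h1, h2, h3⟩ := append_left P Q (Finset.mem_range.1 hj)
    rw [h1, h2, h3]
  · refine Finset.sum_congr rfl fun j _ => ?_
    obtain ⟨h1, h2, h3⟩ := append_right P Q j
    rw [h1, h2, h3]

theorem kurzweilSum_single {τ : ℝ} (hab : a < b) (hτ : τ ∈ Icc a b) (G : ℝ → ℝ → X) :
    (single hab hτ).kurzweilSum G = G τ b - G τ a := by
  simp [kurzweilSum, single]

/-- Termwise estimates of a Kurzweil sum against an additive function add up. -/
theorem norm_kurzweilSum_sub_le (P : TaggedPartition a b) {G : ℝ → ℝ → X} {F : ℝ → X}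
    {m : ℝ → ℝ} (h : ∀ j < P.ν, ‖G (P.tag j) (P.pt (j + 1)) - G (P.tag j) (P.pt j) -
      (F (P.pt (j + 1)) - F (P.pt j))‖ ≤ m (P.pt (j + 1)) - m (P.pt j)) :
    ‖P.kurzweilSum G - (F b - F a)‖ ≤ m b - m a := by
  have h1 : F b - F a = ∑ j ∈ Finset.range P.ν, (F (P.pt (j + 1)) - F (P.pt j)) := by
    rw [Finset.sum_range_sub (fun j => F (P.pt j)), P.pt_zero, P.pt_last]
  have h2 : m b - m a = ∑ j ∈ Finset.range P.ν, (m (P.pt (j + 1)) - m (P.pt j)) := by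
    rw [Finset.sum_range_sub (fun j => m (P.pt j)), P.pt_zero, P.pt_last]
  rw [h1, h2, kurzweilSum, ← Finset.sum_sub_distrib]
  exact norm_sum_le_of_le _ fun j hj => h j (Finset.mem_range.1 hj)

end TaggedPartition

/-! ### Kurzweil integrals and local primitives -/

section Integral

variable {X : Type*} [NormedAddCommGroup X] {G G' : ℝ → ℝ → X} {a b c : ℝ} {I I' : X}

theorem IsGauge.min {δ δ' : ℝ → ℝ} (h : IsGauge δ a b) (h' : IsGauge δ' a b) :
    IsGauge (fun t => min (δ t) (δ' t)) a b := fun t ht => lt_min (h t ht) (h' t ht)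

theorem IsGauge.mono {δ : ℝ → ℝ} {a' b' : ℝ} (h : IsGauge δ a b) (ha : a ≤ a') (hb : b' ≤ b) :
    IsGauge δ a' b' := fun t ht => h t ⟨ha.trans ht.1, ht.2.trans hb⟩

theorem HasKurzweilIntegral.congr (h : HasKurzweilIntegral G a b I)
    (hG : ∀ τ ∈ Icc a b, ∀ t ∈ Icc a b, G τ t = G' τ t) : HasKurzweilIntegral G' a b I := by
  intro ε hε
  obtain ⟨δ, hδ, H⟩ := h ε hε
  refine ⟨δ, hδ, fun P hP => ?_⟩
  convert H P hP using 3
  refine Finset.sum_congr rfl fun j hj => ?_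
  have hj := Finset.mem_range.1 hj
  rw [hG _ (P.tag_mem_Icc hj) _ (P.pt_mem (j := j + 1) hj),
    hG _ (P.tag_mem_Icc hj) _ (P.pt_mem hj.le)]

theorem HasKurzweilIntegral.sub (h : HasKurzweilIntegral G a b I)
    (h' : HasKurzweilIntegral G' a b I') :
    HasKurzweilIntegral (fun τ t => G τ t - G' τ t) a b (I - I') := by
  intro ε hε
  obtain ⟨δ, hδ, H⟩ := h (ε / 2) (by linarith)
  obtain ⟨δ', hδ', H'⟩ := h' (ε / 2) (by linarith)
  refine ⟨_, hδ.min hδ', fun P hP => ?_⟩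
  have h1 := H P (hP.mono fun t => min_le_left _ _)
  have h2 := H' P (hP.mono fun t => min_le_right _ _)
  have : P.kurzweilSum (fun τ t => G τ t - G' τ t) - (I - I') =
      (P.kurzweilSum G - I) - (P.kurzweilSum G' - I') := by
    have h3 : P.kurzweilSum (fun τ t => G τ t - G' τ t) =
        P.kurzweilSum G - P.kurzweilSum G' := by
      simp only [TaggedPartition.kurzweilSum]
      rw [← Finset.sum_sub_distrib]
      exact Finset.sum_congr rfl fun j _ => by abel
    rw [h3]; abel
  rw [this]
  linarith [norm_sub_le (P.kurzweilSum G - I) (P.kurzweilSum G' - I')]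

theorem HasKurzweilIntegral.map [NormedSpace ℝ X] {Y : Type*} [NormedAddCommGroup Y]
    [NormedSpace ℝ Y] (L : X →L[ℝ] Y) (h : HasKurzweilIntegral G a b I) :
    HasKurzweilIntegral (fun τ t => L (G τ t)) a b (L I) := by
  intro ε hε
  have hL : 0 < ‖L‖ + 1 := by positivity
  obtain ⟨δ, hδ, H⟩ := h (ε / (‖L‖ + 1)) (by positivity)
  refine ⟨δ, hδ, fun P hP => ?_⟩
  have h1 : P.kurzweilSum (fun τ t => L (G τ t)) - L I = L (P.kurzweilSum G - I) := by
    simp [TaggedPartition.kurzweilSum, map_sum]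
  have h2 := H P hP
  rw [lt_div_iff₀ hL] at h2
  rw [h1]
  nlinarith [L.le_opNorm (P.kurzweilSum G - I), norm_nonneg (P.kurzweilSum G - I)]

theorem HasKurzweilIntegral.eq_zero_of_refl (h : HasKurzweilIntegral G a a I) : I = 0 := by
  by_contra hI
  obtain ⟨δ, -, H⟩ := h ‖I‖ (norm_pos_iff.2 hI)
  simpa [TaggedPartition.kurzweilSum, TaggedPartition.refl] using
    H (TaggedPartition.refl a) (TaggedPartition.isFine_refl a δ)

/-- One partition of `[a, b]` fine for both gauges, put in front of any fine partition of `[b, c]`,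
gives a fine partition of `[a, c]`. The transition matrix equation only provides integrals based at
`s`; this yields those on other subintervals. -/
theorem HasKurzweilIntegral.sub_left (hab : a ≤ b) (hbc : b ≤ c)
    (h : HasKurzweilIntegral G a b I) (h' : HasKurzweilIntegral G a c I') :
    HasKurzweilIntegral G b c (I' - I) := by
  intro ε hε
  obtain ⟨δ, hδ, H⟩ := h (ε / 2) (by linarith)
  obtain ⟨δ', hδ', H'⟩ := h' (ε / 2) (by linarith)
  refine ⟨δ', hδ'.mono hab le_rfl, fun Q hQ => ?_⟩
  obtain ⟨P, hP⟩ := TaggedPartition.exists_isFine hab (hδ.min (hδ'.mono le_rfl hbc))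
  have h1 := H P (hP.mono fun t => min_le_left _ _)
  have h2 := H' _ ((hP.mono fun t => min_le_right _ _).append hQ)
  rw [TaggedPartition.kurzweilSum_append] at h2
  have : Q.kurzweilSum G - (I' - I) =
    (P.kurzweilSum G + Q.kurzweilSum G - I') - (P.kurzweilSum G - I) := by abel
  rw [this]
  linarith [norm_sub_le (P.kurzweilSum G + Q.kurzweilSum G - I') (P.kurzweilSum G - I)]

theorem HasKurzweilIntegral.sub_right (hab : a ≤ b) (hbc : b ≤ c)
    (h : HasKurzweilIntegral G b c I) (h' : HasKurzweilIntegral G a c I') :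
    HasKurzweilIntegral G a b (I' - I) := by
  intro ε hε
  obtain ⟨δ, hδ, H⟩ := h (ε / 2) (by linarith)
  obtain ⟨δ', hδ', H'⟩ := h' (ε / 2) (by linarith)
  refine ⟨δ', hδ'.mono le_rfl hbc, fun Q hQ => ?_⟩
  obtain ⟨P, hP⟩ := TaggedPartition.exists_isFine hbc (hδ.min (hδ'.mono hab le_rfl))
  have h1 := H P (hP.mono fun t => min_le_left _ _)
  have h2 := H' _ (hQ.append (hP.mono fun t => min_le_right _ _))
  rw [TaggedPartition.kurzweilSum_append] at h2
  have : Q.kurzweilSum G - (I' - I) =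
    (Q.kurzweilSum G + P.kurzweilSum G - I') - (P.kurzweilSum G - I) := by abel
  rw [this]
  linarith [norm_sub_le (Q.kurzweilSum G + P.kurzweilSum G - I') (P.kurzweilSum G - I)]

/-- `F` behaves near every point `τ` of `J` like `G τ`, up to `o(μ)`. -/
def IsLocalPrimitiveOn (G : ℝ → ℝ → X) (μ : ℝ → ℝ) (J : Set ℝ) (F : ℝ → X) : Prop :=
  ∀ τ ∈ J, ∀ ε > 0, ∀ᶠ u in 𝓝[J] τ, ‖F u - F τ - (G τ u - G τ τ)‖ ≤ ε * |μ u - μ τ|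

theorem IsLocalPrimitiveOn.mono {μ : ℝ → ℝ} {J J' : Set ℝ} {F : ℝ → X}
    (h : IsLocalPrimitiveOn G μ J F) (hJ : J' ⊆ J) : IsLocalPrimitiveOn G μ J' F :=
  fun τ hτ ε hε => nhdsWithin_mono _ hJ (h τ (hJ hτ) ε hε)

/-- Splitting each subinterval at its tag bounds its error by a small multiple of the increment of
`μ`, and these increments telescope. -/
theorem IsLocalPrimitiveOn.hasKurzweilIntegral {μ : ℝ → ℝ} (hμ : Monotone μ) {F : ℝ → X}
    (hab : a ≤ b) (h : IsLocalPrimitiveOn G μ (Icc a b) F) :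
    HasKurzweilIntegral G a b (F b - F a) := by
  intro ε hε
  have hμab := hμ hab
  -- The `+ 1` covers `μ a = μ b` and makes the final inequality strict.
  set η := ε / (μ b - μ a + 1) with hη
  have hη0 : 0 < η := div_pos hε (by linarith)
  have : ∀ τ, ∃ δ, τ ∈ Icc a b → 0 < δ ∧ ∀ u ∈ Icc a b, u ∈ Ioo (τ - δ) (τ + δ) →
      ‖F u - F τ - (G τ u - G τ τ)‖ ≤ η * |μ u - μ τ| := by
    intro τ
    by_cases hτ : τ ∈ Icc a b
    · obtain ⟨δ, hδ, H⟩ := Metric.mem_nhdsWithin_iff.1 (h τ hτ η hη0)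
      refine ⟨δ, fun _ => ⟨hδ, fun u hu hu' => H ⟨?_, hu⟩⟩⟩
      rw [Real.ball_eq_Ioo]
      exact hu'
    · exact ⟨0, fun h => absurd h hτ⟩
  choose δ hδ using this
  refine ⟨δ, fun t ht => (hδ t ht).1, fun P hP => ?_⟩
  refine (P.norm_kurzweilSum_sub_le (F := F) (m := fun t => η * μ t) fun j hj => ?_).trans_lt ?_
  · obtain ⟨-, H⟩ := hδ _ (P.tag_mem_Icc hj)
    have hlt := (P.pt_lt j hj).le
    have h1 := H _ (P.pt_mem hj.le) (hP j hj ⟨le_rfl, hlt⟩)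
    have h2 := H _ (P.pt_mem (j := j + 1) hj) (hP j hj ⟨hlt, le_rfl⟩)
    obtain ⟨h3, h4⟩ := P.tag_mem j hj
    rw [abs_of_nonpos (by linarith [hμ h3])] at h1
    rw [abs_of_nonneg (by linarith [hμ h4])] at h2
    set p := P.pt j
    set q := P.pt (j + 1)
    set τ := P.tag j
    have h5 : G τ q - G τ p - (F q - F p) =
      (F p - F τ - (G τ p - G τ τ)) - (F q - F τ - (G τ q - G τ τ)) := by abel
    rw [h5]
    refine (norm_sub_le _ _).trans ?_
    linarith
  · have : η * (μ b - μ a + 1) = ε := div_mul_cancel₀ _ (by linarith)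
    nlinarith

/-- A Kurzweil integral over a short interval is close to the increment at the left end point. -/
theorem HasKurzweilIntegral.eventually_right {F : ℝ → X} (hab : a ≤ b)
    (h : ∀ u v, a ≤ u → u ≤ v → v ≤ b → HasKurzweilIntegral G u v (F v - F u)) {ε : ℝ}
    (hε : 0 < ε) : ∃ η > 0, ∀ v ∈ Icc a b, v < a + η → ‖F v - F a - (G a v - G a a)‖ ≤ ε := by
  obtain ⟨δ, hδ, H⟩ := h a b le_rfl hab le_rfl (ε / 2) (by linarith)
  refine ⟨δ a, hδ a ⟨le_rfl, hab⟩, fun v hv hva => ?_⟩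
  rcases hv.1.eq_or_lt with rfl | hav
  · simpa using hε.le
  obtain ⟨δ', hδ', H'⟩ := h v b hv.1 hv.2 le_rfl (ε / 2) (by linarith)
  -- Saks–Henstock for one interval: `[a, v]` tagged at `a` is completed by a partition of `[v, b]`
  -- fine for both integrals, whose contribution cancels.
  obtain ⟨P, hP⟩ := TaggedPartition.exists_isFine hv.2 ((hδ.mono hv.1 le_rfl).min hδ')
  have h1 := H' P (hP.mono fun t => min_le_right _ _)
  have h2 := H _ ((TaggedPartition.isFine_single hav (left_mem_Icc.2 hav.le)
    (by linarith [hδ a ⟨le_rfl, hab⟩]) hva).append (hP.mono fun t => min_le_left _ _))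
  rw [TaggedPartition.kurzweilSum_append, TaggedPartition.kurzweilSum_single] at h2
  have : F v - F a - (G a v - G a a) = (P.kurzweilSum G - (F b - F v)) -
    (G a v - G a a + P.kurzweilSum G - (F b - F a)) := by abel
  rw [this]
  exact (norm_sub_le _ _).trans (by linarith)

/-- A Kurzweil integral over a short interval is close to the increment at the right end point. -/
theorem HasKurzweilIntegral.eventually_left {F : ℝ → X} (hab : a ≤ b)
    (h : ∀ u v, a ≤ u → u ≤ v → v ≤ b → HasKurzweilIntegral G u v (F v - F u)) {ε : ℝ}
    (hε : 0 < ε) : ∃ η > 0, ∀ u ∈ Icc a b, b - η < u → ‖F u - F b - (G b u - G b b)‖ ≤ ε := by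
  obtain ⟨δ, hδ, H⟩ := h a b le_rfl hab le_rfl (ε / 2) (by linarith)
  refine ⟨δ b, hδ b ⟨hab, le_rfl⟩, fun u hu hub => ?_⟩
  rcases hu.2.eq_or_lt with rfl | hub'
  · simpa using hε.le
  obtain ⟨δ', hδ', H'⟩ := h a u le_rfl hu.1 hu.2 (ε / 2) (by linarith)
  obtain ⟨P, hP⟩ := TaggedPartition.exists_isFine hu.1 ((hδ.mono le_rfl hu.2).min hδ')
  have h1 := H' P (hP.mono fun t => min_le_right _ _)
  have h2 := H _ ((hP.mono fun t => min_le_left _ _).append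
    (TaggedPartition.isFine_single hub' (right_mem_Icc.2 hub'.le) hub
      (by linarith [hδ b ⟨hab, le_rfl⟩])))
  rw [TaggedPartition.kurzweilSum_append, TaggedPartition.kurzweilSum_single] at h2
  have : F u - F b - (G b u - G b b) = (P.kurzweilSum G + (G b b - G b u) - (F b - F a)) -
    (P.kurzweilSum G - (F u - F a)) := by abel
  rw [this]
  exact (norm_sub_le _ _).trans (by linarith)

end Integral

/-! ### Functions with increments controlled by a monotone function -/

section Increments

variable {X : Type*} [NormedAddCommGroup X] {A : ℝ → X} {μ : ℝ → ℝ}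

/-- The increments of `A` are bounded by those of `μ`. -/
def IncrementsLE (A : ℝ → X) (μ : ℝ → ℝ) : Prop :=
  ∀ ⦃u v : ℝ⦄, u ≤ v → ‖A v - A u‖ ≤ μ v - μ u

theorem IncrementsLE.monotone (h : IncrementsLE A μ) : Monotone μ := fun _ _ huv =>
  sub_nonneg.1 ((norm_nonneg _).trans (h huv))

theorem IncrementsLE.comp_neg (h : IncrementsLE A μ) :
    IncrementsLE (fun t => A (-t)) (fun t => -μ (-t)) := fun u v huv => by
  have := h (neg_le_neg huv)
  rw [norm_sub_rev] at this
  linarith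

/-- The strict `t < s` leaves out a possible jump of `μ` at `t`; the rest is the Cauchy property at
the right limit. -/
theorem exists_increment_right_lt {μ : ℝ → ℝ} (hμ : Monotone μ) (t : ℝ) {ε : ℝ} (hε : 0 < ε) :
    ∃ δ > 0, ∀ s v, t < s → s ≤ v → v < t + δ → μ v - μ s < ε := by
  have h := (hμ.tendsto_rightLim t).eventually
    (gt_mem_nhds (show Function.rightLim μ t < Function.rightLim μ t + ε by linarith))
  obtain ⟨b, hb, H⟩ := mem_nhdsGT_iff_exists_Ioo_subset.1 h
  refine ⟨b - t, sub_pos.2 hb, fun s v h1 h2 h3 => ?_⟩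
  have h4 : μ v < Function.rightLim μ t + ε := H ⟨h1.trans_le h2, by linarith⟩
  linarith [hμ.rightLim_le h1]

theorem exists_increment_left_lt {μ : ℝ → ℝ} (hμ : Monotone μ) (t : ℝ) {ε : ℝ} (hε : 0 < ε) :
    ∃ δ > 0, ∀ u s, t - δ < u → u ≤ s → s < t → μ s - μ u < ε := by
  have h := (hμ.tendsto_leftLim t).eventually
    (lt_mem_nhds (show Function.leftLim μ t - ε < Function.leftLim μ t by linarith))
  obtain ⟨b, hb, H⟩ := mem_nhdsLT_iff_exists_Ioo_subset.1 h
  refine ⟨t - b, sub_pos.2 hb, fun u s h1 h2 h3 => ?_⟩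
  have h4 : Function.leftLim μ t - ε < μ u := H ⟨by linarith, h2.trans_lt h3⟩
  linarith [hμ.le_leftLim h3]

theorem IncrementsLE.tendsto_rightLim [CompleteSpace X] (h : IncrementsLE A μ) (t : ℝ) :
    Tendsto A (𝓝[>] t) (𝓝 (Function.rightLim A t)) := by
  refine tendsto_rightLim_of_tendsto (cauchy_map_iff_exists_tendsto.1 ?_)
  refine Metric.cauchy_iff.2 ⟨inferInstance, fun ε hε => ?_⟩
  obtain ⟨δ, hδ, H⟩ := exists_increment_right_lt h.monotone t hε
  refine ⟨A '' Ioo t (t + δ), image_mem_map (Ioo_mem_nhdsGT (by linarith)), ?_⟩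
  rintro _ ⟨u, hu, rfl⟩ _ ⟨v, hv, rfl⟩
  rcases le_total u v with huv | huv
  · rw [dist_comm, dist_eq_norm]
    exact (h huv).trans_lt (H u v hu.1 huv hv.2)
  · rw [dist_eq_norm]
    exact (h huv).trans_lt (H v u hv.1 huv hu.2)

theorem IncrementsLE.tendsto_leftLim [CompleteSpace X] (h : IncrementsLE A μ) (t : ℝ) :
    Tendsto A (𝓝[<] t) (𝓝 (Function.leftLim A t)) := by
  refine tendsto_leftLim_of_tendsto (cauchy_map_iff_exists_tendsto.1 ?_)
  refine Metric.cauchy_iff.2 ⟨inferInstance, fun ε hε => ?_⟩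
  obtain ⟨δ, hδ, H⟩ := exists_increment_left_lt h.monotone t hε
  refine ⟨A '' Ioo (t - δ) t, image_mem_map (Ioo_mem_nhdsLT (by linarith)), ?_⟩
  rintro _ ⟨u, hu, rfl⟩ _ ⟨v, hv, rfl⟩
  rcases le_total u v with huv | huv
  · rw [dist_comm, dist_eq_norm]
    exact (h huv).trans_lt (H u v hu.1 huv hv.2)
  · rw [dist_eq_norm]
    exact (h huv).trans_lt (H v u hv.1 huv hu.2)

end Increments

/-! ### Zeros of solutions and uniqueness -/

section Uniqueness

variable {E : Type*} [NormedAddCommGroup E] [NormedSpace ℝ E] {A : ℝ → E →L[ℝ] E} {μ : ℝ → ℝ}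
  {x : ℝ → E} {a b : ℝ}

theorem IsSolutionOn.mono {J J' : Set ℝ} (h : IsSolutionOn A J x) (hJ : J' ⊆ J) :
    IsSolutionOn A J' x := fun c d hcd hJ' => h c d hcd (hJ'.trans hJ)

theorem IsSolutionOn.sub {J : Set ℝ} {y : ℝ → E} (h : IsSolutionOn A J x)
    (h' : IsSolutionOn A J y) : IsSolutionOn A J (fun t => x t - y t) := fun c d hcd hJ => by
  have := (h c d hcd hJ).sub (h' c d hcd hJ)
  simp only [← map_sub] at this
  rwa [sub_sub_sub_comm] at this

/-- The increment of a solution, compared with its value at `t₀`: the increments of `A` between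
`t₀` and its neighbours do not enter the bound. -/
theorem norm_increment_sub_le {t₀ M : ℝ} (hab : a ≤ b)
    (h : HasKurzweilIntegral (fun τ t => A t (x τ)) a b (x b - x a))
    {m : ℝ → ℝ} (hm : MonotoneOn m (Icc a b))
    (hA : ∀ p ∈ Icc a b, ∀ q ∈ Icc a b, p ≤ q → p ≠ t₀ → q ≠ t₀ → ‖A q - A p‖ ≤ m q - m p)
    (hM : ∀ s ∈ Icc a b, ‖x s - x t₀‖ ≤ M) (hM0 : 0 ≤ M) :
    ‖x b - x a - (A b - A a) (x t₀)‖ ≤ M * (m b - m a) := by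
  refine le_of_forall_pos_le_add fun ε hε => ?_
  obtain ⟨δ, hδ, H⟩ := h ε hε
  -- Away from `t₀` the gauge is at most `|s - t₀|`, so every subinterval containing `t₀` is tagged
  -- by `t₀` and contributes no error.
  obtain ⟨P, hP⟩ := TaggedPartition.exists_isFine hab
    (δ := fun s => if s = t₀ then δ s else min (δ s) |s - t₀|) (by
      intro s hs
      by_cases hst : s = t₀
      · simpa [hst] using hst ▸ hδ s hs
      · simpa [hst, hδ s hs] using sub_ne_zero.2 hst)
  have h1 := H P (hP.mono fun t => by
    by_cases ht : t = t₀
    · simp [ht]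
    · simp [ht])
  have h2 := P.norm_kurzweilSum_sub_le (G := fun τ t => A t (x τ)) (F := fun t => A t (x t₀))
    (m := fun t => M * m t) (fun j hj => by
      have hp := P.pt_mem hj.le
      have hq := P.pt_mem (j := j + 1) hj
      have hpq := (P.pt_lt j hj).le
      have hτ := P.tag_mem_Icc hj
      have hf := hP j hj
      set p := P.pt j
      set q := P.pt (j + 1)
      by_cases ht : P.tag j = t₀
      · rw [ht]
        simpa [← mul_sub] using mul_nonneg hM0 (sub_nonneg.2 (hm hp hq hpq))
      · have hne : t₀ ∉ Icc p q := fun hmem => by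
          have h3 := hf hmem
          simp only [ht, if_false] at h3
          have h4 : min (δ (P.tag j)) |P.tag j - t₀| ≤ |P.tag j - t₀| := min_le_right _ _
          rcases abs_cases (P.tag j - t₀) with h5 | h5 <;> linarith [h3.1, h3.2]
        have h3 := hA p hp q hq hpq (fun h => hne ⟨h.le, h ▸ hpq⟩) (fun h => hne ⟨h ▸ hpq, h.ge⟩)
        have h4 : A q (x (P.tag j)) - A p (x (P.tag j)) - (A q (x t₀) - A p (x t₀)) =
            (A q - A p) (x (P.tag j) - x t₀) := by
          simp only [map_sub, sub_apply]
        rw [h4, ← mul_sub, mul_comm]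
        exact (A q - A p).le_of_opNorm_le_of_le h3 (hM _ hτ))
  have h3 : x b - x a - (A b - A a) (x t₀) =
      (P.kurzweilSum (fun τ t => A t (x τ)) - (A b (x t₀) - A a (x t₀))) -
      (P.kurzweilSum (fun τ t => A t (x τ)) - (x b - x a)) := by
    simp only [sub_apply]; abel
  rw [h3]
  refine (norm_sub_le _ _).trans ?_
  rw [mul_sub]
  linarith

/-- Raising or lowering `μ` at the single point `a` to `μ b - κ` keeps it monotone on `[a, b]` and
makes its total increase `κ`: the jump at `a` is not charged. -/
theorem norm_increment_right_le {M κ : ℝ} (hA : IncrementsLE A μ) (hab : a < b)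
    (h : HasKurzweilIntegral (fun τ t => A t (x τ)) a b (x b - x a))
    (hκ : ∀ s, a < s → s ≤ b → μ b - μ s ≤ κ)
    (hM : ∀ s ∈ Icc a b, ‖x s - x a‖ ≤ M) :
    ‖x b - x a - (A b - A a) (x a)‖ ≤ M * κ := by
  have := norm_increment_sub_le (m := fun s => if s = a then μ b - κ else μ s) hab.le h ?_ ?_ hM
    ((norm_nonneg _).trans (hM a ⟨le_rfl, hab.le⟩))
  · simpa [hab.ne'] using this
  · intro p hp q hq hpq
    by_cases h1 : q = a
    · have : p = a := le_antisymm (h1 ▸ hpq) hp.1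
      simp [h1, this]
    · have h2 := hκ q (lt_of_le_of_ne hq.1 (Ne.symm h1)) hq.2
      by_cases h3 : p = a
      · simp only [h1, h3, if_true, if_false]; linarith
      · simpa [h1, h3] using hA.monotone hpq
  · intro p _ q _ hpq h1 h2
    simpa [h1, h2] using hA hpq

theorem norm_increment_left_le {M κ : ℝ} (hA : IncrementsLE A μ) (hab : a < b)
    (h : HasKurzweilIntegral (fun τ t => A t (x τ)) a b (x b - x a))
    (hκ : ∀ s, a ≤ s → s < b → μ s - μ a ≤ κ)
    (hM : ∀ s ∈ Icc a b, ‖x s - x b‖ ≤ M) :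
    ‖x b - x a - (A b - A a) (x b)‖ ≤ M * κ := by
  have := norm_increment_sub_le (m := fun s => if s = b then μ a + κ else μ s) hab.le h ?_ ?_ hM
    ((norm_nonneg _).trans (hM a ⟨le_rfl, hab.le⟩))
  · simpa [hab.ne] using this
  · intro p hp q hq hpq
    by_cases h1 : p = b
    · have : q = b := le_antisymm hq.2 (h1 ▸ hpq)
      simp [h1, this]
    · have h2 := hκ p hp.1 (lt_of_le_of_ne hp.2 h1)
      by_cases h3 : q = b
      · simp only [h1, h3, if_true, if_false]; linarith
      · simpa [h1, h3] using hA.monotone hpq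
  · intro p _ q _ hpq h1 h2
    simpa [h1, h2] using hA hpq

theorem eq_zero_of_forall_norm_le_half_pow {X : Type*} [NormedAddCommGroup X] {y : X}
    (h : ∀ n : ℕ, ‖y‖ ≤ (1 / 2 : ℝ) ^ n) :
    y = 0 :=
  norm_le_zero_iff.1 <| ge_of_tendsto'
    (tendsto_pow_atTop_nhds_zero_of_lt_one (by norm_num) (by norm_num)) h

/-- The integral bounds `x` by `1` near `a`; since `x a = 0`, the increment estimate with `κ = 1/2`
then halves any bound on this neighbourhood. Invertibility plays no role here. -/
theorem IsSolutionOn.eventually_eq_zero_right (hA : IncrementsLE A μ) (hab : a ≤ b)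
    (h : IsSolutionOn A (Icc a b) x) (h0 : x a = 0) :
    ∃ δ > 0, ∀ v ∈ Icc a b, v < a + δ → x v = 0 := by
  have hint : ∀ u v, a ≤ u → u ≤ v → v ≤ b →
      HasKurzweilIntegral (fun τ t => A t (x τ)) u v (x v - x u) :=
    fun u v h1 h2 h3 => h u v h2 (Icc_subset_Icc h1 h3)
  obtain ⟨δ, hδ, H⟩ := HasKurzweilIntegral.eventually_right hab hint one_pos
  obtain ⟨δ', hδ', H'⟩ := exists_increment_right_lt hA.monotone a (ε := 1 / 2) (by norm_num)
  have key : ∀ n : ℕ, ∀ v ∈ Icc a b, v < a + min δ δ' → ‖x v‖ ≤ (1 / 2 : ℝ) ^ n := by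
    intro n
    induction n with
    | zero =>
      intro v hv hv'
      simpa [h0] using H v hv (hv'.trans_le (by linarith [min_le_left δ δ']))
    | succ n ih =>
      intro v hv hv'
      rcases hv.1.eq_or_lt with rfl | hav
      · rw [h0, norm_zero]; positivity
      · have := norm_increment_right_le (M := (1 / 2 : ℝ) ^ n) (κ := 1 / 2) hA hav
          (hint a v le_rfl hv.1 hv.2)
          (fun s h1 h2 => (H' s v h1 h2 (hv'.trans_le (by linarith [min_le_right δ δ']))).le)
          (fun s hs => by
            rw [h0, sub_zero]
            exact ih s ⟨hs.1, hs.2.trans hv.2⟩ (hs.2.trans_lt hv'))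
        simpa [h0, pow_succ] using this
  exact ⟨min δ δ', lt_min hδ hδ', fun v hv hv' =>
    eq_zero_of_forall_norm_le_half_pow fun n => key n v hv hv'⟩

theorem IsSolutionOn.eventually_eq_zero_left (hA : IncrementsLE A μ) (hab : a ≤ b)
    (h : IsSolutionOn A (Icc a b) x) (h0 : x b = 0) :
    ∃ δ > 0, ∀ u ∈ Icc a b, b - δ < u → x u = 0 := by
  have hint : ∀ u v, a ≤ u → u ≤ v → v ≤ b →
      HasKurzweilIntegral (fun τ t => A t (x τ)) u v (x v - x u) :=
    fun u v h1 h2 h3 => h u v h2 (Icc_subset_Icc h1 h3)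
  obtain ⟨δ, hδ, H⟩ := HasKurzweilIntegral.eventually_left hab hint one_pos
  obtain ⟨δ', hδ', H'⟩ := exists_increment_left_lt hA.monotone b (ε := 1 / 2) (by norm_num)
  have key : ∀ n : ℕ, ∀ u ∈ Icc a b, b - min δ δ' < u → ‖x u‖ ≤ (1 / 2 : ℝ) ^ n := by
    intro n
    induction n with
    | zero =>
      intro v hv hv'
      simpa [h0] using H v hv (lt_of_le_of_lt (by linarith [min_le_left δ δ']) hv')
    | succ n ih =>
      intro u hu hu'
      rcases hu.2.eq_or_lt with rfl | hub
      · rw [h0, norm_zero]; positivity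
      · have := norm_increment_left_le (M := (1 / 2 : ℝ) ^ n) (κ := 1 / 2) hA hub
          (hint u b hu.1 hu.2 le_rfl)
          (fun s h1 h2 =>
            (H' u s (lt_of_le_of_lt (by linarith [min_le_right δ δ']) hu') h1 h2).le)
          (fun s hs => by
            rw [h0, sub_zero]
            exact ih s ⟨hu.1.trans hs.1, hs.2⟩ (hu'.trans_le hs.1))
        simpa [h0, pow_succ] using this
  exact ⟨min δ δ', lt_min hδ hδ', fun v hv hv' =>
    eq_zero_of_forall_norm_le_half_pow fun n => key n v hv hv'⟩

theorem apply_ne_zero_of_isUnit {B : E →L[ℝ] E} (hB : IsUnit B) {y : E} (hy : y ≠ 0) :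
    B y ≠ 0 := by
  obtain ⟨B', hB'⟩ := hB.exists_left_inv
  intro h
  have : (B' * B) y = 0 := by rw [mul_apply_eq_comp, h, map_zero]
  rw [hB'] at this
  exact hy this

/-- The right limit of `x` at `a` is `z = (I + Δ⁺A(a)) x(a) ≠ 0`; a zero too close to `a` would give
`‖z‖ < ‖z‖`. -/
theorem IsSolutionOn.eventually_ne_zero_right [CompleteSpace E] (hA : IncrementsLE A μ)
    (hab : a ≤ b) (h : IsSolutionOn A (Icc a b) x)
    (hu : IsUnit (1 + (Function.rightLim A a - A a))) (h0 : x a ≠ 0) :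
    ∃ δ > 0, ∀ v ∈ Icc a b, v < a + δ → x v ≠ 0 := by
  have hz := norm_pos_iff.2 (apply_ne_zero_of_isUnit hu h0)
  set z := (1 + (Function.rightLim A a - A a)) (x a) with hzdef
  obtain ⟨δ, hδ, H⟩ := HasKurzweilIntegral.eventually_right hab
    (fun u v h1 h2 h3 => h u v h2 (Icc_subset_Icc h1 h3)) (half_pos hz)
  have hlim : Tendsto (fun v => A v (x a)) (𝓝[>] a) (𝓝 (Function.rightLim A a (x a))) :=
    ((ContinuousLinearMap.apply ℝ E (x a)).continuous.tendsto _).comp (hA.tendsto_rightLim a)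
  obtain ⟨c, hc, H'⟩ := mem_nhdsGT_iff_exists_Ioo_subset.1
    (Metric.tendsto_nhds.1 hlim _ (half_pos hz))
  refine ⟨min δ (c - a), lt_min hδ (sub_pos.2 hc), fun v hv hv' hxv => ?_⟩
  rcases hv.1.eq_or_lt with rfl | hav
  · exact h0 hxv
  have h1 := H v hv (hv'.trans_le (by linarith [min_le_left δ (c - a)]))
  have h2 : dist (A v (x a)) (Function.rightLim A a (x a)) < ‖z‖ / 2 :=
    H' ⟨hav, hv'.trans_le (by linarith [min_le_right δ (c - a)])⟩
  rw [dist_eq_norm] at h2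
  have h3 : z = -((x v - x a - (A v (x a) - A a (x a))) +
      (A v (x a) - Function.rightLim A a (x a))) := by
    rw [hxv, hzdef]
    simp only [add_apply, sub_apply,
      one_apply_eq_self]
    abel
  have h4 := norm_add_le (x v - x a - (A v (x a) - A a (x a)))
    (A v (x a) - Function.rightLim A a (x a))
  rw [← norm_neg, ← h3] at h4
  linarith

/-- Invertibility is asked only when `a < b`, because `ConditionD` says nothing about a left jump at
`0`. -/
theorem IsSolutionOn.eventually_ne_zero_left [CompleteSpace E] (hA : IncrementsLE A μ)
    (hab : a ≤ b) (h : IsSolutionOn A (Icc a b) x)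
    (hu : a < b → IsUnit (1 - (A b - Function.leftLim A b))) (h0 : x b ≠ 0) :
    ∃ δ > 0, ∀ u ∈ Icc a b, b - δ < u → x u ≠ 0 := by
  rcases hab.eq_or_lt with rfl | hab'
  · exact ⟨1, one_pos, fun u hu _ => by rwa [le_antisymm hu.2 hu.1]⟩
  have hz := norm_pos_iff.2 (apply_ne_zero_of_isUnit (hu hab') h0)
  set z := (1 - (A b - Function.leftLim A b)) (x b) with hzdef
  obtain ⟨δ, hδ, H⟩ := HasKurzweilIntegral.eventually_left hab
    (fun u v h1 h2 h3 => h u v h2 (Icc_subset_Icc h1 h3)) (half_pos hz)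
  have hlim : Tendsto (fun v => A v (x b)) (𝓝[<] b) (𝓝 (Function.leftLim A b (x b))) :=
    ((ContinuousLinearMap.apply ℝ E (x b)).continuous.tendsto _).comp (hA.tendsto_leftLim b)
  obtain ⟨c, hc, H'⟩ := mem_nhdsLT_iff_exists_Ioo_subset.1
    (Metric.tendsto_nhds.1 hlim _ (half_pos hz))
  refine ⟨min δ (b - c), lt_min hδ (sub_pos.2 hc), fun v hv hv' hxv => ?_⟩
  rcases hv.2.eq_or_lt with rfl | hvb
  · exact h0 hxv
  have h1 := H v hv (lt_of_le_of_lt (by linarith [min_le_left δ (b - c)]) hv')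
  have h2 : dist (A v (x b)) (Function.leftLim A b (x b)) < ‖z‖ / 2 :=
    H' ⟨lt_of_le_of_lt (by linarith [min_le_right δ (b - c)]) hv', hvb⟩
  rw [dist_eq_norm] at h2
  have h3 : z = -((x v - x b - (A v (x b) - A b (x b))) +
      (A v (x b) - Function.leftLim A b (x b))) := by
    rw [hxv, hzdef]
    simp only [sub_apply, one_apply_eq_self]
    abel
  have h4 := norm_add_le (x v - x b - (A v (x b) - A b (x b)))
    (A v (x b) - Function.leftLim A b (x b))
  rw [← norm_neg, ← h3] at h4
  linarith

/-- A solution that vanishes at one end point of an interval vanishes at the other. -/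
theorem IsSolutionOn.eq_zero_iff [CompleteSpace E] (hA : IncrementsLE A μ) (hD : ConditionD A)
    (ha : 0 ≤ a) (hab : a ≤ b) (h : IsSolutionOn A (Icc a b) x) : x a = 0 ↔ x b = 0 := by
  refine interval_induction (P := fun u v => x u = 0 ↔ x v = 0) hab
    (fun u v w _ _ _ _ h1 h2 => h1.trans h2) fun t ht => ?_
  have hl := h.mono (Icc_subset_Icc le_rfl ht.2)
  have hr := h.mono (Icc_subset_Icc ht.1 le_rfl)
  by_cases h0 : x t = 0
  · obtain ⟨δ, hδ, H⟩ := hl.eventually_eq_zero_left hA ht.1 h0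
    obtain ⟨δ', hδ', H'⟩ := hr.eventually_eq_zero_right hA ht.2 h0
    refine ⟨min δ δ', lt_min hδ hδ', fun u hu h1 h2 => ?_, fun v hv h1 h2 => ?_⟩
    · simp [h0, H u ⟨hu.1, h2⟩ (lt_of_le_of_lt (by linarith [min_le_left δ δ']) h1)]
    · simp [h0, H' v ⟨h1, hv.2⟩ (h2.trans_le (by linarith [min_le_right δ δ']))]
  · obtain ⟨δ, hδ, H⟩ := hl.eventually_ne_zero_left hA ht.1
      (fun hat => hD.1 t (ha.trans_lt hat)) h0
    obtain ⟨δ', hδ', H'⟩ := hr.eventually_ne_zero_right hA ht.2 (hD.2 t (ha.trans ht.1)) h0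
    refine ⟨min δ δ', lt_min hδ hδ', fun u hu h1 h2 => ?_, fun v hv h1 h2 => ?_⟩
    · simp [h0, H u ⟨hu.1, h2⟩ (lt_of_le_of_lt (by linarith [min_le_left δ δ']) h1)]
    · simp [h0, H' v ⟨h1, hv.2⟩ (h2.trans_le (by linarith [min_le_right δ δ']))]

end Uniqueness

/-! ### Local existence by Euler steps and compactness -/

section Existence

variable {R : Type*} [NormedRing R] {A : ℝ → R} {μ : ℝ → ℝ} {x : ℝ → R} {K : ℝ}

/-- Quantitative form, for the pair `u < v`, of `x` being a solution of `dx/dτ = D[A(t)x]`. -/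
structure IncrementEstimate (A : ℝ → R) (μ : ℝ → ℝ) (K : ℝ) (x : ℝ → R) (u v : ℝ) : Prop where
  norm_le : ‖x v - x u‖ ≤ K * (μ v - μ u)
  left : ‖x v - x u - (A v - A u) * x u‖ ≤ K * (μ v - Function.rightLim μ u) * (μ v - μ u)
  right : ‖x v - x u - (A v - A u) * x v‖ ≤ K * (Function.leftLim μ v - μ u) * (μ v - μ u)

theorem IncrementEstimate.congr {y : ℝ → R} {u v : ℝ} (h : IncrementEstimate A μ K x u v)
    (hu : x u = y u) (hv : x v = y v) : IncrementEstimate A μ K y u v where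
  norm_le := by rw [← hu, ← hv]; exact h.norm_le
  left := by rw [← hu, ← hv]; exact h.left
  right := by rw [← hu, ← hv]; exact h.right

theorem norm_step_le {a b y z : R} {α β K : ℝ} (h : z - y = a * y + b * z) (ha : ‖a‖ ≤ α)
    (hb : ‖b‖ ≤ β) (hy : ‖y‖ ≤ K) (hz : ‖z‖ ≤ K) : ‖z - y‖ ≤ K * (α + β) := by
  rw [h]
  refine (norm_add_le _ _).trans ?_
  linarith [norm_mul_le_of_le ha hy, norm_mul_le_of_le hb hz]

/-- One implicit-explicit Euler step with intermediate point `m`. -/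
theorem incrementEstimate_step (hA : IncrementsLE A μ) {s m t : ℝ} (hsm : s < m) (hmt : m < t)
    (h : x t - x s = (A m - A s) * x s + (A t - A m) * x t) (hs : ‖x s‖ ≤ K) (ht : ‖x t‖ ≤ K) :
    IncrementEstimate A μ K x s t := by
  have hμ := hA.monotone
  have hK : 0 ≤ K := (norm_nonneg _).trans hs
  have h1 := hA hsm.le
  have h2 := hA hmt.le
  have hn : ‖x t - x s‖ ≤ K * (μ t - μ s) :=
    (norm_step_le h h1 h2 hs ht).trans_eq (by ring)
  have hst : 0 ≤ μ t - μ s := sub_nonneg.2 (hμ (hsm.trans hmt).le)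
  have hKst := mul_nonneg hK hst
  refine ⟨hn, ?_, ?_⟩
  · have h3 : x t - x s - (A t - A s) * x s =
        (x t - x s - ((A m - A s) * x s + (A t - A m) * x t)) + (A t - A m) * (x t - x s) := by
      noncomm_ring
    rw [h3, sub_eq_zero.2 h, zero_add]
    refine (norm_mul_le_of_le h2 hn).trans ?_
    nlinarith [mul_nonneg hKst (sub_nonneg.2 (hμ.rightLim_le hsm))]
  · have h3 : x t - x s - (A t - A s) * x t =
        (x t - x s - ((A m - A s) * x s + (A t - A m) * x t)) - (A m - A s) * (x t - x s) := by
      noncomm_ring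
    rw [h3, sub_eq_zero.2 h, zero_sub, norm_neg]
    refine (norm_mul_le_of_le h1 hn).trans ?_
    nlinarith [mul_nonneg hKst (sub_nonneg.2 (hμ.le_leftLim hmt))]

/-- The old error and the new terms are products of increments of `μ` that fit into the product for
the longer interval, so `K` does not grow with the number of steps. -/
theorem IncrementEstimate.trans_step (hA : IncrementsLE A μ) {u s m t : ℝ} (hus : u < s)
    (hsm : s < m) (hmt : m < t) (hest : IncrementEstimate A μ K x u s)
    (h : x t - x s = (A m - A s) * x s + (A t - A m) * x t) (hs : ‖x s‖ ≤ K) (ht : ‖x t‖ ≤ K) :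
    IncrementEstimate A μ K x u t := by
  have hμ := hA.monotone
  have hK : 0 ≤ K := (norm_nonneg _).trans hs
  have h1 := hA hsm.le
  have h2 := hA hmt.le
  have hn : ‖x t - x s‖ ≤ K * (μ t - μ s) :=
    (norm_step_le h h1 h2 hs ht).trans_eq (by ring)
  have hst : 0 ≤ μ t - μ s := sub_nonneg.2 (hμ (hsm.trans hmt).le)
  have hn' : ‖x t - x u‖ ≤ K * (μ t - μ u) := by
    rw [← sub_add_sub_cancel (x t) (x s) (x u)]
    exact (norm_add_le_of_le hn hest.norm_le).trans_eq (by ring)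
  refine ⟨hn', ?_, ?_⟩
  · have h3 : x t - x u - (A t - A u) * x u =
        (x t - x s - ((A m - A s) * x s + (A t - A m) * x t)) +
          ((x s - x u - (A s - A u) * x u) + (A m - A s) * (x s - x u) +
            (A t - A m) * (x t - x u)) := by
      noncomm_ring
    rw [h3, sub_eq_zero.2 h, zero_add]
    refine (norm_add_le_of_le (norm_add_le_of_le hest.left (norm_mul_le_of_le h1 hest.norm_le))
      (norm_mul_le_of_le h2 hn')).trans ?_
    nlinarith [mul_nonneg (mul_nonneg hK hst)
      (sub_nonneg.2 (hμ.rightLim_le (hus.trans hsm)))]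
  · have h3 : x t - x u - (A t - A u) * x t =
        (x t - x s - ((A m - A s) * x s + (A t - A m) * x t)) +
          ((x s - x u - (A s - A u) * x s) - (A m - A u) * (x t - x s)) := by
      noncomm_ring
    rw [h3, sub_eq_zero.2 h, zero_add]
    refine (norm_sub_le_of_le hest.right
      (norm_mul_le_of_le (hA (hus.trans hsm).le) hn)).trans ?_
    have h4 := mul_nonneg (mul_nonneg hK hst) (sub_nonneg.2 (hμ.le_leftLim hmt))
    have h5 := mul_nonneg (mul_nonneg hK (sub_nonneg.2 (hμ hus.le)))
      (sub_nonneg.2 (hμ.leftLim (hsm.trans hmt).le))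
    nlinarith

/-- The Neumann series inverts `1 - b`, and `1 / (1 - β) ≤ 1 + 2β` for `β ≤ 1/2`. The exponential
form makes the growth factors of successive steps multiply to one depending only on the total
increment of `μ`. -/
theorem exists_step [CompleteSpace R] {a b y : R} {α β : ℝ} (ha : ‖a‖ ≤ α) (hb : ‖b‖ ≤ β)
    (hβ : β ≤ 1 / 2) :
    ∃ z, z - y = a * y + b * z ∧ ‖z‖ ≤ Real.exp (2 * (α + β)) * ‖y‖ := by
  have hα0 := (norm_nonneg _).trans ha
  have hβ0 := (norm_nonneg _).trans hb
  have hb1 : ‖b‖ < 1 := by linarith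
  set w := Units.oneSub b hb1
  have hw : (1 - b) * (↑w⁻¹ * (y + a * y)) = y + a * y := by
    rw [← Units.val_oneSub b hb1, Units.mul_inv_cancel_left]
  set z := ↑w⁻¹ * (y + a * y)
  have hz : z = y + a * y + b * z := by
    rw [← hw]; noncomm_ring
  refine ⟨z, ?_, ?_⟩
  · exact sub_eq_iff_eq_add.2 (hz.trans (by abel))
  · have h1 : ‖z‖ ≤ ‖y‖ + α * ‖y‖ + β * ‖z‖ := by
      conv_lhs => rw [hz]
      exact norm_add_le_of_le (norm_add_le_of_le le_rfl (norm_mul_le_of_le ha le_rfl))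
        (norm_mul_le_of_le hb le_rfl)
    have h2 : 1 + 2 * β ≤ Real.exp (2 * β) := by linarith [Real.add_one_le_exp (2 * β)]
    have h3 : 1 + α ≤ Real.exp (2 * α) := by linarith [Real.add_one_le_exp (2 * α)]
    have h4 : ‖z‖ ≤ (1 + 2 * β) * ((1 + α) * ‖y‖) := by
      have h5 : (1 - β) * ‖z‖ ≤ (1 + α) * ‖y‖ := by linarith
      have h6 := mul_le_mul_of_nonneg_left h5 (show 0 ≤ 1 + 2 * β by linarith)
      have h7 := mul_nonneg (mul_nonneg hβ0 (norm_nonneg z)) (show 0 ≤ 1 - 2 * β by linarith)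
      nlinarith
    refine h4.trans ?_
    rw [mul_add, Real.exp_add, mul_comm (Real.exp (2 * α)), mul_assoc]
    gcongr

/-- Discrete solutions on finite sets, with estimates that do not depend on the set. -/
theorem exists_discrete_solution [CompleteSpace R] (hA : IncrementsLE A μ) {a b : ℝ}
    (hsmall : ∀ s t, a < s → s ≤ t → t ≤ b → μ t - μ s ≤ 1 / 2) (S : Finset ℝ)
    (hS : ∀ t ∈ S, a < t ∧ t ≤ b) :
    ∃ x : ℝ → R, x a = 1 ∧
      (∀ t ∈ insert a S, ‖x t‖ ≤ Real.exp (2 * (μ t - μ a)) * ‖(1 : R)‖) ∧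
      ∀ u ∈ insert a S, ∀ v ∈ insert a S, u < v →
        IncrementEstimate A μ (Real.exp (2 * (μ b - μ a)) * ‖(1 : R)‖) x u v := by
  induction S using Finset.induction_on_max with
  | empty =>
    refine ⟨fun _ => 1, rfl, by simp, ?_⟩
    intro u hu v hv huv
    simp only [Finset.mem_insert, Finset.notMem_empty, or_false] at hu hv
    exact absurd huv (by simp [hu, hv])
  | insert t S htS ih =>
    obtain ⟨x, hxa, hx, hest⟩ := ih fun s hs => hS s (Finset.mem_insert_of_mem hs)
    obtain ⟨hat, htb⟩ := hS t (Finset.mem_insert_self _ _)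
    have hT : (insert a S).Nonempty := ⟨a, Finset.mem_insert_self _ _⟩
    set s := (insert a S).max' hT with hs
    have hsT : s ∈ insert a S := Finset.max'_mem _ _
    have hlt : ∀ u ∈ insert a S, u < t := by
      intro u hu
      rcases Finset.mem_insert.1 hu with rfl | hu
      · exact hat
      · exact htS u hu
    have has : a ≤ s := Finset.le_max' _ _ (Finset.mem_insert_self _ _)
    have hst := hlt s hsT
    have hsm : s < (s + t) / 2 := by linarith
    have hmt : (s + t) / 2 < t := by linarith
    set m := (s + t) / 2
    -- Since `m > a` even when `s = a`, the implicit half has variation at most `1/2`; a large jump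
    -- at `a` falls into the explicit half.
    obtain ⟨y, hy, hyn⟩ := exists_step (y := x s) (hA hsm.le) (hA hmt.le)
      (hsmall m t (by linarith) hmt.le htb)
    have hyn' : ‖y‖ ≤ Real.exp (2 * (μ t - μ a)) * ‖(1 : R)‖ := by
      refine hyn.trans ((mul_le_mul_of_nonneg_left (hx s hsT) (Real.exp_pos _).le).trans_eq ?_)
      rw [← mul_assoc, ← Real.exp_add]
      congr 2
      ring
    have hKle : ∀ r ≤ b, Real.exp (2 * (μ r - μ a)) * ‖(1 : R)‖ ≤
        Real.exp (2 * (μ b - μ a)) * ‖(1 : R)‖ := by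
      intro r hr
      have := hA.monotone hr
      gcongr
    set x' := Function.update x t y with hx'
    have hx't : x' t = y := Function.update_self ..
    have hx'u : ∀ u ∈ insert a S, x' u = x u := fun u hu =>
      Function.update_of_ne (hlt u hu).ne _ _
    have hstep : x' t - x' s = (A m - A s) * x' s + (A t - A m) * x' t := by
      rw [hx't, hx'u s hsT, hy]
    have hns : ‖x' s‖ ≤ Real.exp (2 * (μ b - μ a)) * ‖(1 : R)‖ := by
      rw [hx'u s hsT]
      exact (hx s hsT).trans (hKle s (hst.le.trans htb))
    have hnt : ‖x' t‖ ≤ Real.exp (2 * (μ b - μ a)) * ‖(1 : R)‖ := by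
      rw [hx't]
      exact hyn'.trans (hKle t htb)
    refine ⟨x', ?_, ?_, ?_⟩
    · rw [hx'u a (Finset.mem_insert_self _ _), hxa]
    · intro u hu
      rw [Finset.insert_comm] at hu
      rcases Finset.mem_insert.1 hu with rfl | hu
      · rwa [hx't]
      · rw [hx'u u hu]
        exact hx u hu
    · intro u hu v hv huv
      rw [Finset.insert_comm] at hu hv
      rcases Finset.mem_insert.1 hv with rfl | hv
      · have hu : u ∈ insert a S := (Finset.mem_insert.1 hu).resolve_left huv.ne
        rcases (Finset.le_max' _ _ hu).eq_or_lt with h | h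
        · rw [h, ← hs]
          exact incrementEstimate_step hA hsm hmt hstep hns hnt
        · rw [← hs] at h
          exact ((hest u hu s hsT h).congr (hx'u u hu).symm (hx'u s hsT).symm).trans_step
            hA h hsm hmt hstep hns hnt
      · have hu : u ∈ insert a S :=
          (Finset.mem_insert.1 hu).resolve_left (huv.trans (hlt v hv)).ne
        exact (hest u hu v hv huv).congr (hx'u u hu).symm (hx'u v hv).symm

/-- A limit of discrete solutions along an ultrafilter of finite sets. -/
theorem exists_incrementEstimate [ProperSpace R] (hA : IncrementsLE A μ) {a b : ℝ}
    (hsmall : ∀ s t, a < s → s ≤ t → t ≤ b → μ t - μ s ≤ 1 / 2) :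
    ∃ (x : ℝ → R) (K : ℝ), x a = 1 ∧
      ∀ u v, a ≤ u → u < v → v ≤ b → IncrementEstimate A μ K x u v := by
  set K := Real.exp (2 * (μ b - μ a)) * ‖(1 : R)‖
  have H := fun S : Finset ℝ => exists_discrete_solution (R := R) hA hsmall
    (S.filter fun t => a < t ∧ t ≤ b) (fun t ht => (Finset.mem_filter.1 ht).2)
  choose X hXa hX hest using H
  -- Each point eventually belongs to `S`, and along an ultrafilter all the bounded values `X S t`
  -- converge simultaneously.
  let 𝒰 : Ultrafilter (Finset ℝ) := Ultrafilter.of atTop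
  have h𝒰 : ∀ t, ∀ᶠ S in (𝒰 : Filter (Finset ℝ)), t ∈ S := fun t =>
    Ultrafilter.of_le _ ((eventually_ge_atTop {t}).mono fun S hS => hS (by simp))
  have hmem : ∀ t, a ≤ t → t ≤ b → ∀ᶠ S in (𝒰 : Filter (Finset ℝ)),
      t ∈ insert a (S.filter fun t => a < t ∧ t ≤ b) := by
    intro t hat htb
    filter_upwards [h𝒰 t] with S hS
    rcases hat.eq_or_lt with rfl | hat
    · exact Finset.mem_insert_self _ _
    · exact Finset.mem_insert_of_mem (Finset.mem_filter.2 ⟨hS, hat, htb⟩)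
  have hlim : ∀ t, ∃ y, a ≤ t → t ≤ b → Tendsto (fun S => X S t) 𝒰 (𝓝 y) := by
    intro t
    by_cases ht : a ≤ t ∧ t ≤ b
    · obtain ⟨y, -, hy⟩ := (isCompact_closedBall (0 : R)
        (Real.exp (2 * (μ t - μ a)) * ‖(1 : R)‖)).ultrafilter_le_nhds (𝒰.map fun S => X S t) (by
          refine le_principal_iff.2 ((hmem t ht.1 ht.2).mono fun S hS => ?_)
          simpa using hX S t hS)
      exact ⟨y, fun _ _ => hy⟩
    · exact ⟨0, fun h1 h2 => absurd ⟨h1, h2⟩ ht⟩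
  choose x hx using hlim
  -- The default value `1` gives `x a = 1` even when `b < a`.
  refine ⟨fun t => if a ≤ t ∧ t ≤ b then x t else 1, K, ?_, fun u v hau huv hvb => ?_⟩
  · simp only
    split_ifs with h
    · exact tendsto_nhds_unique (hx a h.1 h.2) (by simp only [hXa]; exact tendsto_const_nhds)
    · rfl
  · have hu := hx u hau (huv.le.trans hvb)
    have hv := hx v (hau.trans huv.le) hvb
    have hev : ∀ᶠ S in (𝒰 : Filter (Finset ℝ)), IncrementEstimate A μ K (X S) u v := by
      filter_upwards [hmem u hau (huv.le.trans hvb), hmem v (hau.trans huv.le) hvb]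
        with S h1 h2 using hest S u h1 v h2 huv
    have hest : IncrementEstimate A μ K x u v :=
      ⟨le_of_tendsto (hv.sub hu).norm (hev.mono fun S h => h.norm_le),
        le_of_tendsto ((hv.sub hu).sub (hu.const_mul _)).norm (hev.mono fun S h => h.left),
        le_of_tendsto ((hv.sub hu).sub (hv.const_mul _)).norm (hev.mono fun S h => h.right)⟩
    exact hest.congr (if_pos ⟨hau, huv.le.trans hvb⟩).symm
      (if_pos ⟨hau.trans huv.le, hvb⟩).symm

/-- The factors `μ v - μ(τ⁺)` and `μ(τ⁻) - μ u` tend to `0` as `v ↓ τ` and `u ↑ τ`, even at a jump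
of `μ`. -/
theorem isLocalPrimitiveOn_of_incrementEstimate (hμ : Monotone μ) {a b : ℝ}
    (h : ∀ u v, a ≤ u → u < v → v ≤ b → IncrementEstimate A μ K x u v) :
    IsLocalPrimitiveOn (fun τ t => A t * x τ) μ (Icc a b) x := by
  intro τ hτ ε hε
  have hr : ∀ᶠ v in 𝓝 τ, τ < v → K * (μ v - Function.rightLim μ τ) < ε := by
    have h1 := ((hμ.tendsto_rightLim τ).sub_const (Function.rightLim μ τ)).const_mul K
    rw [sub_self, mul_zero] at h1
    exact eventually_nhdsWithin_iff.1 (h1.eventually (gt_mem_nhds hε))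
  have hl : ∀ᶠ u in 𝓝 τ, u < τ → K * (Function.leftLim μ τ - μ u) < ε := by
    have h1 := ((hμ.tendsto_leftLim τ).const_sub (Function.leftLim μ τ)).const_mul K
    rw [sub_self, mul_zero] at h1
    exact eventually_nhdsWithin_iff.1 (h1.eventually (gt_mem_nhds hε))
  filter_upwards [mem_nhdsWithin_of_mem_nhds hr, mem_nhdsWithin_of_mem_nhds hl,
    self_mem_nhdsWithin] with u h1 h2 hu
  simp only [← sub_mul]
  rcases lt_trichotomy u τ with hlt | rfl | hlt
  · have h3 := (h u τ hu.1 hlt hτ.2).right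
    have h4 := sub_nonneg.2 (hμ hlt.le)
    rw [abs_of_nonpos (by linarith), ← norm_neg]
    have h5 : -(x u - x τ - (A u - A τ) * x τ) = x τ - x u - (A τ - A u) * x τ := by
      noncomm_ring
    rw [h5, neg_sub]
    exact h3.trans (mul_le_mul_of_nonneg_right (h2 hlt).le h4)
  · simp
  · have h4 := sub_nonneg.2 (hμ hlt.le)
    rw [abs_of_nonneg h4]
    exact (h τ u hτ.1 hlt hu.2).left.trans (mul_le_mul_of_nonneg_right (h1 hlt).le h4)

/-- Local existence to the right. -/
theorem exists_localPrimitive_right [ProperSpace R] (hA : IncrementsLE A μ) (t : ℝ) :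
    ∃ δ > 0, ∀ b < t + δ, ∃ x : ℝ → R, x t = 1 ∧
      IsLocalPrimitiveOn (fun τ t => A t * x τ) μ (Icc t b) x := by
  obtain ⟨δ, hδ, H⟩ := exists_increment_right_lt hA.monotone t (ε := 1 / 2) (by norm_num)
  refine ⟨δ, hδ, fun b hb => ?_⟩
  obtain ⟨x, K, h1, h2⟩ := exists_incrementEstimate (R := R) hA (a := t) (b := b)
    fun s v h1 h2 h3 => (H s v h1 h2 (h3.trans_lt hb)).le
  exact ⟨x, h1, isLocalPrimitiveOn_of_incrementEstimate hA.monotone h2⟩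

/-- Local existence to the left. -/
theorem exists_localPrimitive_left [ProperSpace R] (hA : IncrementsLE A μ) (t : ℝ) :
    ∃ δ > 0, ∀ a, t - δ < a → ∃ x : ℝ → R, x t = 1 ∧
      IsLocalPrimitiveOn (fun τ t => A t * x τ) μ (Icc a t) x := by
  -- Local primitives have no preferred direction, so the reflection `t ↦ -t` exchanges the two
  -- sides.
  obtain ⟨δ, hδ, H⟩ := exists_localPrimitive_right hA.comp_neg (-t)
  refine ⟨δ, hδ, fun a ha => ?_⟩
  obtain ⟨x, h1, h2⟩ := H (-a) (by linarith)
  refine ⟨fun s => x (-s), h1, fun τ hτ ε hε => ?_⟩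
  have h3 : Tendsto (fun u : ℝ => -u) (𝓝[Icc a t] τ) (𝓝[Icc (-t) (-a)] (-τ)) :=
    tendsto_nhdsWithin_iff.2 ⟨(continuous_neg.tendsto τ).mono_left nhdsWithin_le_nhds,
      eventually_nhdsWithin_of_forall fun u hu => ⟨neg_le_neg hu.2, neg_le_neg hu.1⟩⟩
  filter_upwards [h3.eventually (h2 (-τ) ⟨neg_le_neg hτ.2, neg_le_neg hτ.1⟩ ε hε)] with u hu
  simp only [neg_neg] at hu
  rwa [neg_sub_neg, abs_sub_comm] at hu

end Existence

/-! ### Renormalizing and gluing local solutions -/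

section MatrixSolution

variable {R : Type*} [NormedRing R] {A : ℝ → R} {μ : ℝ → ℝ} {x y : ℝ → R}

/-- `x` is a local solution of `dx/dτ = D[A(t)x]`, with errors measured by `μ`. -/
def IsLocalSolutionOn (A : ℝ → R) (μ : ℝ → ℝ) (J : Set ℝ) (x : ℝ → R) : Prop :=
  IsLocalPrimitiveOn (fun τ t => A t * x τ) μ J x

theorem IsLocalSolutionOn.mono {J J' : Set ℝ} (h : IsLocalSolutionOn A μ J x) (hJ : J' ⊆ J) :
    IsLocalSolutionOn A μ J' x :=
  IsLocalPrimitiveOn.mono h hJ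

theorem IsLocalSolutionOn.congr {J : Set ℝ} (h : IsLocalSolutionOn A μ J x) (hxy : EqOn x y J) :
    IsLocalSolutionOn A μ J y := by
  intro τ hτ ε hε
  filter_upwards [h τ hτ ε hε, self_mem_nhdsWithin] with u hu huJ
  rwa [← hxy hτ, ← hxy huJ]

theorem IsLocalSolutionOn.mul_right {J : Set ℝ} (h : IsLocalSolutionOn A μ J x) (B : R) :
    IsLocalSolutionOn A μ J (fun t => x t * B) := by
  intro τ hτ ε hε
  have hB : 0 < ‖B‖ + 1 := by positivity
  filter_upwards [h τ hτ (ε / (‖B‖ + 1)) (by positivity)] with u hu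
  have h1 : x u * B - x τ * B - (A u * (x τ * B) - A τ * (x τ * B)) =
      (x u - x τ - (A u * x τ - A τ * x τ)) * B := by noncomm_ring
  rw [h1]
  refine (norm_mul_le_of_le hu le_rfl).trans ?_
  have h2 : ε / (‖B‖ + 1) * (‖B‖ + 1) = ε := div_mul_cancel₀ _ hB.ne'
  have h3 : 0 ≤ ε / (‖B‖ + 1) * |μ u - μ τ| := by positivity
  calc ε / (‖B‖ + 1) * |μ u - μ τ| * ‖B‖
      ≤ ε / (‖B‖ + 1) * |μ u - μ τ| * (‖B‖ + 1) := by gcongr; linarith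
    _ = ε / (‖B‖ + 1) * (‖B‖ + 1) * |μ u - μ τ| := by ring
    _ = ε * |μ u - μ τ| := by rw [h2]

/-- A point outside a closed set has a neighbourhood missing it, so only the sets containing `τ`
impose a condition. -/
theorem IsLocalSolutionOn.union {J J' : Set ℝ} (hJ : IsClosed J) (hJ' : IsClosed J')
    (h : IsLocalSolutionOn A μ J x) (h' : IsLocalSolutionOn A μ J' x) :
    IsLocalSolutionOn A μ (J ∪ J') x := by
  intro τ _ ε hε
  rw [nhdsWithin_union, eventually_sup]
  constructor
  · by_cases hτ : τ ∈ J
    · exact h τ hτ ε hε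
    · rw [notMem_closure_iff_nhdsWithin_eq_bot.1 (hJ.closure_eq.symm ▸ hτ)]
      exact eventually_bot
  · by_cases hτ : τ ∈ J'
    · exact h' τ hτ ε hε
    · rw [notMem_closure_iff_nhdsWithin_eq_bot.1 (hJ'.closure_eq.symm ▸ hτ)]
      exact eventually_bot

theorem IsLocalSolutionOn.glue {a b c : ℝ} (hab : a ≤ b) (hbc : b ≤ c)
    (h : IsLocalSolutionOn A μ (Icc a b) x) (h' : IsLocalSolutionOn A μ (Icc b c) y)
    (hxy : x b = y b) : IsLocalSolutionOn A μ (Icc a c) (fun t => if t ≤ b then x t else y t) := by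
  rw [← Icc_union_Icc_eq_Icc hab hbc]
  refine (h.congr fun t ht => (if_pos ht.2).symm).union isClosed_Icc isClosed_Icc
    (h'.congr fun t ht => ?_)
  rcases ht.1.eq_or_lt with rfl | hlt
  · simp [hxy]
  · simp [hlt.not_ge]

end MatrixSolution

/-! ### Fundamental matrix, transition matrix and stability -/

section Fundamental

variable {E : Type*} [NormedAddCommGroup E] [NormedSpace ℝ E] {A : ℝ → E →L[ℝ] E} {μ : ℝ → ℝ}
  {Φ Ψ : ℝ → E →L[ℝ] E} {a b : ℝ}

theorem IsLocalSolutionOn.isSolutionOn (hμ : Monotone μ)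
    (h : IsLocalSolutionOn A μ (Icc a b) Φ) (v : E) :
    IsSolutionOn A (Icc a b) (fun t => Φ t v) := fun _ _ hcd hJ =>
  ((IsLocalPrimitiveOn.mono h hJ).hasKurzweilIntegral hμ hcd).map
    (ContinuousLinearMap.apply ℝ E v)

theorem isUnit_of_forall_apply_eq_zero [FiniteDimensional ℝ E] {B : E →L[ℝ] E}
    (h : ∀ v, B v = 0 → v = 0) : IsUnit B := by
  have : CompleteSpace E := FiniteDimensional.complete ℝ E
  have hinj : Function.Injective (B : E →ₗ[ℝ] E) := (injective_iff_map_eq_zero _).2 h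
  exact ContinuousLinearMap.isUnit_iff_bijective.2
    ⟨hinj, LinearMap.injective_iff_surjective.1 hinj⟩

theorem IsTransitionMatrix.self_eq {U : ℝ → ℝ → E →L[ℝ] E} (hU : IsTransitionMatrix A U) {s : ℝ}
    (hs : 0 ≤ s) : U s s = ContinuousLinearMap.id ℝ E :=
  sub_eq_zero.1 ((hU s s hs hs).1 le_rfl).eq_zero_of_refl

theorem IsTransitionMatrix.isSolutionOn_Ici {U : ℝ → ℝ → E →L[ℝ] E} (hU : IsTransitionMatrix A U)
    {s : ℝ} (hs : 0 ≤ s) (v : E) : IsSolutionOn A (Ici s) (fun t => U t s v) := by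
  intro c d hcd hJ
  have hsc : s ≤ c := hJ ⟨le_rfl, hcd⟩
  have h := HasKurzweilIntegral.sub_left hsc hcd ((hU c s (hs.trans hsc) hs).1 hsc)
    ((hU d s (hs.trans (hsc.trans hcd)) hs).1 (hsc.trans hcd))
  rw [sub_sub_sub_cancel_right] at h
  exact h.map (ContinuousLinearMap.apply ℝ E v)

theorem IsTransitionMatrix.isSolutionOn_Icc {U : ℝ → ℝ → E →L[ℝ] E} (hU : IsTransitionMatrix A U)
    {s : ℝ} (hs : 0 ≤ s) (v : E) : IsSolutionOn A (Icc 0 s) (fun t => U t s v) := by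
  have key : ∀ c, 0 ≤ c → c ≤ s → HasKurzweilIntegral (fun τ r => A r ∘L U τ s) c s
      (ContinuousLinearMap.id ℝ E - U c s) := by
    intro c hc hcs
    rcases hcs.eq_or_lt with rfl | hcs
    · simpa [hU.self_eq hs] using (hU c c hs hs).1 le_rfl
    · simpa using (hU c s hc hs).2 hcs
  intro c d hcd hJ
  have hc : 0 ≤ c := (hJ ⟨le_rfl, hcd⟩).1
  have hds : d ≤ s := (hJ ⟨hcd, le_rfl⟩).2
  have h := HasKurzweilIntegral.sub_right hcd hds (key d (hc.trans hcd) hds)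
    (key c hc (hcd.trans hds))
  rw [sub_sub_sub_cancel_left] at h
  exact h.map (ContinuousLinearMap.apply ℝ E v)

variable [FiniteDimensional ℝ E]

/-- For each `v`, `t ↦ Φ t v` is a solution, so `Φ a` and `Φ b` have the same kernel. -/
theorem IsLocalSolutionOn.isUnit_iff (hA : IncrementsLE A μ) (hD : ConditionD A)
    (ha : 0 ≤ a) (hab : a ≤ b)
    (h : IsLocalSolutionOn A μ (Icc a b) Φ) : IsUnit (Φ a) ↔ IsUnit (Φ b) := by
  have : CompleteSpace E := FiniteDimensional.complete ℝ E
  have key := fun v => (h.isSolutionOn hA.monotone v).eq_zero_iff hA hD ha hab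
  constructor
  · refine fun hu => isUnit_of_forall_apply_eq_zero fun v hv => ?_
    by_contra hne
    exact apply_ne_zero_of_isUnit hu hne ((key v).2 hv)
  · refine fun hu => isUnit_of_forall_apply_eq_zero fun v hv => ?_
    by_contra hne
    exact apply_ne_zero_of_isUnit hu hne ((key v).1 hv)

theorem IsLocalSolutionOn.unique (hA : IncrementsLE A μ) (hD : ConditionD A)
    (ha : 0 ≤ a) (hab : a ≤ b)
    (h : IsLocalSolutionOn A μ (Icc a b) Φ) (h' : IsLocalSolutionOn A μ (Icc a b) Ψ)
    (heq : Φ a = Ψ a) : Φ b = Ψ b := by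
  have : CompleteSpace E := FiniteDimensional.complete ℝ E
  ext v
  exact sub_eq_zero.1 ((((h.isSolutionOn hA.monotone v).sub
    (h'.isSolutionOn hA.monotone v)).eq_zero_iff hA hD ha hab).1 (by simp [heq]))

theorem exists_isLocalSolutionOn (hA : IncrementsLE A μ) (hD : ConditionD A)
    (hb : 0 ≤ b) :
    ∃ Φ : ℝ → E →L[ℝ] E, Φ 0 = 1 ∧ IsLocalSolutionOn A μ (Icc 0 b) Φ := by
  have : ProperSpace (E →L[ℝ] E) := FiniteDimensional.proper ℝ _
  refine interval_induction (P := fun u v => ∃ Φ : ℝ → E →L[ℝ] E, Φ u = 1 ∧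
    IsLocalSolutionOn A μ (Icc u v) Φ) hb ?_ fun t ht => ?_
  · rintro u v w - huv hvw - ⟨Φ, hΦ, h⟩ ⟨Ψ, hΨ, h'⟩
    exact ⟨_, by simp [huv, hΦ], h.glue huv hvw (h'.mul_right (Φ v)) (by simp [hΨ])⟩
  · obtain ⟨δ, hδ, H⟩ := exists_localPrimitive_left hA t
    obtain ⟨δ', hδ', H'⟩ := exists_localPrimitive_right hA t
    refine ⟨min δ δ', lt_min hδ hδ', fun u hu h1 h2 => ?_, fun v hv h1 h2 => ?_⟩
    · obtain ⟨Φ, hΦ, h : IsLocalSolutionOn A μ (Icc u t) Φ⟩ :=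
        H u (lt_of_le_of_lt (by linarith [min_le_left δ δ']) h1)
      -- The solution is normalized at `t`; moving the normalization to `u` needs `Φ u` invertible,
      -- which is where the jump condition enters existence.
      have hunit : IsUnit (Φ u) :=
        (h.isUnit_iff hA hD hu.1 h2).2 (by rw [hΦ]; exact isUnit_one)
      exact ⟨_, Ring.mul_inverse_cancel _ hunit, h.mul_right (Ring.inverse (Φ u))⟩
    · exact H' v (h2.trans_le (by linarith [min_le_right δ δ']))

/-- The fundamental matrix of `dx/dτ = D[A(t)x]` on `[0, ∞)`. -/
theorem exists_fundamental_matrix (hA : IncrementsLE A μ) (hD : ConditionD A) :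
    ∃ Φ : ℝ → E →L[ℝ] E, ∀ b, 0 ≤ b → IsUnit (Φ b) ∧ IsLocalSolutionOn A μ (Icc 0 b) Φ := by
  have H : ∀ b : ℝ, ∃ Φ : ℝ → E →L[ℝ] E, 0 ≤ b →
      Φ 0 = 1 ∧ IsLocalSolutionOn A μ (Icc 0 b) Φ := by
    intro b
    by_cases hb : 0 ≤ b
    · obtain ⟨Φ, h⟩ := exists_isLocalSolutionOn hA hD hb
      exact ⟨Φ, fun _ => h⟩
    · exact ⟨0, fun h => absurd h hb⟩
  choose F hF using H
  -- By uniqueness, solutions on different intervals `[0, b]` agree, so the diagonal coincides with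
  -- each of them.
  refine ⟨fun t => F t t, fun b hb => ⟨?_, ?_⟩⟩
  · obtain ⟨h1, h2⟩ := hF b hb
    exact (h2.isUnit_iff hA hD le_rfl hb).1 (by rw [h1]; exact isUnit_one)
  · obtain ⟨h1, h2⟩ := hF b hb
    refine h2.congr fun t ht => ?_
    obtain ⟨h3, h4⟩ := hF t ht.1
    exact (h2.mono (Icc_subset_Icc le_rfl ht.2)).unique hA hD le_rfl ht.1 h4 (h1.trans h3.symm)

theorem exists_isTransitionMatrix (hA : IncrementsLE A μ) (hD : ConditionD A) :
    ∃ U : ℝ → ℝ → E →L[ℝ] E, IsTransitionMatrix A U := by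
  obtain ⟨Φ, hΦ⟩ := exists_fundamental_matrix hA hD
  have key : ∀ r s t : ℝ, 0 ≤ s → s ≤ t → HasKurzweilIntegral
      (fun τ q => A q ∘L (Φ τ * Ring.inverse (Φ r))) s t
      (Φ t * Ring.inverse (Φ r) - Φ s * Ring.inverse (Φ r)) := fun r s t hs hst =>
    IsLocalPrimitiveOn.hasKurzweilIntegral hA.monotone hst
      (((hΦ t (hs.trans hst)).2.mul_right _).mono (Icc_subset_Icc hs le_rfl))
  refine ⟨fun t s => Φ t * Ring.inverse (Φ s), fun t s ht hs => ?_⟩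
  have h1 : Φ s * Ring.inverse (Φ s) = ContinuousLinearMap.id ℝ E :=
    Ring.mul_inverse_cancel _ (hΦ s hs).1
  refine ⟨fun hst => ?_, fun hts => ?_⟩
  · simpa only [h1] using key s s t hs hst
  · simpa only [h1, neg_sub] using key s t s ht hts.le

theorem IsTransitionMatrix.unique (hA : IncrementsLE A μ) (hD : ConditionD A)
    {U V : ℝ → ℝ → E →L[ℝ] E} (hU : IsTransitionMatrix A U)
    (hV : IsTransitionMatrix A V) {t s : ℝ} (ht : 0 ≤ t) (hs : 0 ≤ s) : V t s = U t s := by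
  have : CompleteSpace E := FiniteDimensional.complete ℝ E
  ext v
  rcases le_total s t with hst | hts
  · have h := ((hV.isSolutionOn_Ici hs v).sub (hU.isSolutionOn_Ici hs v)).mono
      (show Icc s t ⊆ Ici s from Icc_subset_Ici_self)
    exact sub_eq_zero.1 ((h.eq_zero_iff hA hD hs hst).1 (by simp [hU.self_eq hs, hV.self_eq hs]))
  · have h := ((hV.isSolutionOn_Icc hs v).sub (hU.isSolutionOn_Icc hs v)).mono
      (Icc_subset_Icc ht le_rfl)
    exact sub_eq_zero.1 ((h.eq_zero_iff hA hD ht hts).2 (by simp [hU.self_eq hs, hV.self_eq hs]))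

theorem IsTransitionMatrix.eq_apply (hA : IncrementsLE A μ) (hD : ConditionD A)
    {U : ℝ → ℝ → E →L[ℝ] E} (hU : IsTransitionMatrix A U)
    {x : ℝ → E} {s t : ℝ} (hs : 0 ≤ s) (hst : s ≤ t) (hx : IsSolutionOn A (Ici s) x) :
    x t = U t s (x s) := by
  have : CompleteSpace E := FiniteDimensional.complete ℝ E
  have h := (hx.sub (hU.isSolutionOn_Ici hs (x s))).mono
    (show Icc s t ⊆ Ici s from Icc_subset_Ici_self)
  exact sub_eq_zero.1 ((h.eq_zero_iff hA hD hs hst).1 (by simp [hU.self_eq hs]))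

theorem IsTransitionMatrix.uniformlyStable_iff (hA : IncrementsLE A μ) (hD : ConditionD A)
    {U : ℝ → ℝ → E →L[ℝ] E}
    (hU : IsTransitionMatrix A U) :
    UniformlyStable A ↔ ∃ C : ℝ, ∀ t s₀ : ℝ, 0 ≤ s₀ → s₀ ≤ t → ‖U t s₀‖ ≤ C := by
  constructor
  · intro h
    obtain ⟨δ, hδ, H⟩ := h 1 one_pos
    refine ⟨2 / δ, fun t s hs hst => ContinuousLinearMap.opNorm_le_bound _ (by positivity)
      fun v => ?_⟩
    rcases eq_or_ne v 0 with rfl | hv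
    · simp
    have hv' := norm_pos_iff.2 hv
    -- The initial vector is `v` rescaled to norm `δ / 2`.
    have h1 := H s hs ((δ / 2 / ‖v‖) • v)
      (by rw [norm_smul, Real.norm_of_nonneg (by positivity), div_mul_cancel₀ _ hv'.ne']; linarith)
      _ (hU.isSolutionOn_Ici hs ((δ / 2 / ‖v‖) • v)) (by simp [hU.self_eq hs]) t hst
    rw [map_smul, norm_smul, Real.norm_of_nonneg (by positivity), div_mul_eq_mul_div,
      div_lt_one hv'] at h1
    rw [div_mul_eq_mul_div, le_div_iff₀ hδ]
    linarith
  · rintro ⟨C, hC⟩ ε hε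
    have hC' : 0 < |C| + 1 := by positivity
    refine ⟨ε / (|C| + 1), by positivity, fun s hs x₀ hx₀ x hx hxs t hst => ?_⟩
    rw [hU.eq_apply hA hD hs hst hx, hxs]
    rw [lt_div_iff₀ hC'] at hx₀
    have h1 := (U t s).le_of_opNorm_le (hC t s hs hst) x₀
    nlinarith [le_abs_self C, norm_nonneg x₀]

end Fundamental

/-! ### Dependence on `A` only through its values on `[0, ∞)` -/

section Congr

variable {E : Type*} [NormedAddCommGroup E] [NormedSpace ℝ E] {A B : ℝ → E →L[ℝ] E}

theorem IsSolutionOn.congr_coeff {J : Set ℝ} {x : ℝ → E} (h : IsSolutionOn A J x)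
    (hAB : EqOn A B J) : IsSolutionOn B J x := fun c d hcd hJ =>
  (h c d hcd hJ).congr fun _ _ t ht => by rw [hAB (hJ ht)]

theorem UniformlyStable.congr (h : UniformlyStable A) (hAB : EqOn A B (Ici 0)) :
    UniformlyStable B := by
  intro ε hε
  obtain ⟨δ, hδ, H⟩ := h ε hε
  exact ⟨δ, hδ, fun s hs x₀ hx₀ x hx => H s hs x₀ hx₀ x
    (hx.congr_coeff fun t ht => (hAB (hs.trans ht)).symm)⟩

theorem IsTransitionMatrix.congr {U : ℝ → ℝ → E →L[ℝ] E} (h : IsTransitionMatrix A U)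
    (hAB : EqOn A B (Ici 0)) : IsTransitionMatrix B U := fun t s ht hs =>
  ⟨fun hst => ((h t s ht hs).1 hst).congr fun _ _ r hr => by rw [hAB (hs.trans hr.1)],
    fun hts => ((h t s ht hs).2 hts).congr fun _ _ r hr => by rw [hAB (ht.trans hr.1)]⟩

/-- The bound on `B` guarantees genuine one-sided limits, which therefore depend only on nearby
values; for `t > 0` these lie in `[0, ∞)` on the left as well. -/
theorem ConditionD.congr [CompleteSpace E] {μ : ℝ → ℝ} (h : ConditionD A) (hB : IncrementsLE B μ)
    (hAB : EqOn A B (Ici 0)) : ConditionD B := by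
  refine ⟨fun t ht => ?_, fun t ht => ?_⟩
  · have h1 : Function.leftLim A t = Function.leftLim B t :=
      leftLim_eq_of_tendsto ((hB.tendsto_leftLim t).congr' <| by
        filter_upwards [Ioo_mem_nhdsLT ht] with u hu using (hAB hu.1.le).symm)
    rw [← hAB ht.le, ← h1]
    exact h.1 t ht
  · have h1 : Function.rightLim A t = Function.rightLim B t :=
      rightLim_eq_of_tendsto ((hB.tendsto_rightLim t).congr' <| by
        filter_upwards [self_mem_nhdsWithin] with u hu using
          (hAB (ht.trans (le_of_lt hu))).symm)
    rw [← hAB ht, ← h1]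
    exact h.2 t ht

/-- Extending `A` by `A 0` to negative times makes the variation function a control on the whole
line, sparing the local lemmas any domain restriction. -/
theorem exists_incrementsLE_of_locallyBoundedVariationOn {X : Type*} [NormedAddCommGroup X]
    {A : ℝ → X} (hA : LocallyBoundedVariationOn A (Ici 0)) :
    ∃ μ, IncrementsLE (fun t => A (max t 0)) μ := by
  refine ⟨fun t => variationOnFromTo A (Ici 0) 0 (max t 0), fun u v huv => ?_⟩
  have h0 : (0 : ℝ) ∈ Ici (0 : ℝ) := self_mem_Ici
  have hu : max u 0 ∈ Ici (0 : ℝ) := mem_Ici.2 (le_max_right _ _)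
  have hv : max v 0 ∈ Ici (0 : ℝ) := mem_Ici.2 (le_max_right _ _)
  have huv' : max u 0 ≤ max v 0 := max_le_max_right 0 huv
  beta_reduce
  rw [← variationOnFromTo.add hA h0 hu hv, add_sub_cancel_left,
    variationOnFromTo.eq_of_le _ _ huv', ← dist_eq_norm, dist_comm, dist_edist]
  exact ENNReal.toReal_mono (hA _ _ hu hv)
    (eVariationOn.edist_le A ⟨hu, le_rfl, huv'⟩ ⟨hv, huv', le_rfl⟩)

end Congr

end GLDE

theorem theorem3p1 {E : Type*} [NormedAddCommGroup E] [NormedSpace ℝ E] [FiniteDimensional ℝ E]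
    (A : ℝ → E →L[ℝ] E) (hA : LocallyBoundedVariationOn A (Set.Ici 0))
    (hD : GLDE.ConditionD A) :
    ∃ U : ℝ → ℝ → E →L[ℝ] E,
      GLDE.IsTransitionMatrix A U ∧
      (∀ V : ℝ → ℝ → E →L[ℝ] E, GLDE.IsTransitionMatrix A V →
        ∀ t s : ℝ, 0 ≤ t → 0 ≤ s → V t s = U t s) ∧
      (GLDE.UniformlyStable A ↔ ∃ C : ℝ, ∀ t s₀ : ℝ, 0 ≤ s₀ → s₀ ≤ t → ‖U t s₀‖ ≤ C) := by
  have : CompleteSpace E := FiniteDimensional.complete ℝ E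
  obtain ⟨μ, hB⟩ := GLDE.exists_incrementsLE_of_locallyBoundedVariationOn hA
  have hAB : EqOn A (fun t => A (max t 0)) (Ici 0) := fun t ht => by simp [max_eq_left ht.out]
  have hDB := hD.congr hB hAB
  obtain ⟨U, hU⟩ := GLDE.exists_isTransitionMatrix hB hDB
  exact ⟨U, hU.congr hAB.symm, fun V hV t s ht hs => hU.unique hB hDB (hV.congr hAB) ht hs,
    Iff.trans ⟨fun h => h.congr hAB, fun h => h.congr hAB.symm⟩ (hU.uniformlyStable_iff hB hDB)⟩
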